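/- Let $N\ge 1$, let $f:\{0,\dots,N\}\to(0,\infty)$ and put $\tilde f(n)=\tfrac12(f(n)+f(n+1))$ for $0\le n\le N-1$. **Controlled chain.** Let $\Omega$ be the space of sequences $(X_t,\xi_t)_{t\ge0}$ with $X_t\in\{0,\dots,N\}$ and $\xi_t\in E$, where $(E,\nu)$ is a probability space (independent additional information; $E$ may be a point). Let $\mathcal F_t$ be generated by $(X_u,\xi_u)_{u\le t}$, and let $M_t=\max_{u\le t}X_u$. A control $s\in\mathcal M$ is a random scale function $s(n)=\sum_{k<n}W(k)$, $0\le n\le N$, with measurable random increments $W(k)>0$, $W(0)=1$, such that $W(k)$ is known once level $k$ has been reached: $W(k)\mathbf 1_{\{k\le M_t\}}$ is $\mathcal F_t$-measurable for all $k,t$. Under the law $\mathbb P^s$ the chain starts at $X_0=0$; given $\mathcal F_t$ and $X_t=x$ with $0<x<N$, it moves to $x+1$ with probability $p_x=1/(1+w_x)$ and to $x-1$ with probability $1-p_x$, where $w_x=W(x)/W(x-1)$; it moves from $0$ to $1$ and from $N$ to $N-1$ with probability one; the $\xi_t$ are i.i.d. with law $\nu$, and $\xi_{t+1}$ is independent of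 $\mathcal F_t$ and $X_{t+1}$. (All laws $\mathbb P^s$ are mutually absolutely continuous on each $\mathcal F_t$.) Let $T_N=\inf\{t:X_t=N\}$ and let $S=\inf\{t>T_N:X_t=0\}$ be the shuttle time. **Notation.** For a control $s$ and $0\le y\le N$ put $$I^s(y)=\sum_{k=0}^{y-1}\frac{2\tilde f(k)}{W(k)},\qquad J([y,N))=\sum_{k=y}^{N-1}\sqrt{2\tilde f(k)},$$ $$\phi_y(x)=\sum_{v=x}^{y-1}f(v)+\sum_{v=x}^{y-1}\sum_{u=0}^{v-1}\frac{2\tilde f(u)W(v)}{W(u)}\quad(x\le y),$$ $$\phi_y(x)=\sum_{v=y+1}^{x}f(v)+\sum_{v=y}^{x-1}\sum_{u=v+1}^{N-1}\frac{2\tilde f(u)W(v)}{W(u)}\quad(y\le x).$$ For $s_0\in\mathcal M$ let $\mathcal M^{s_0}_y$ be the set of controls whose increments agree with those of $s_0$ at all levels $0,\dots,y-1$. **Theorem.** Let $s_0\in\mathcal M$, with increments $W^0(k)$. The Bellman process $$V^{s_0}_t=\operatorname*{ess\,inf}_{s\in\mathcal M^{s_0}_{M_t}}\mathbb E^s\Big[\sum_{u=0}^{S-1}f(X_u)\,\Big|\,\mathcal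 F_t\Big]$$ (that is, on each event $\{M_t=y\}$ it is the $\mathbb P^{s_0}$-essential infimum over $s\in\mathcal M^{s_0}_y$) is given, $\mathbb P^{s_0}$-a.s. for every $t$, by $$V^{s_0}_t=v_t=\begin{cases}\displaystyle\sum_{u=0}^{t-1}f(X_u)+\Big(\sqrt{s_0(M_t)\,I^{s_0}(M_t)}+J([M_t,N))\Big)^2-\phi_{X_t}(0),& M_t<N,\\[2ex]\displaystyle\sum_{u=0}^{(t\wedge S)-1}f(X_u)+\phi_0(X_{t\wedge S}),&M_t=N,\end{cases}$$ where $\phi$ is formed with the increments $W^0$. Moreover the infimum is attained: for every $y\in\{0,\dots,N\}$, with $y'=\max(y,1)$, there is a control $\hat s\in\mathcal M^{s_0}_y$ with increments $$W(x)=\sqrt{\frac{s_0(y')}{I^{s_0}(y')}}\,\sqrt{2\tilde f(x)}\qquad\text{for } y'\le x\le N-1,$$ and for every $t$, $\mathbb P^{s_0}$-a.s. on $\{M_t=y\}$, $$\mathbb E^{\hat s}\Big[\sum_{u=0}^{S-1}f(X_u)\,\Big|\,\mathcal F_t\Big]=v_t.$$ -/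

import Mathlib

open MeasureTheory ProbabilityTheory
open scoped ENNReal

namespace BirthDeath

/-- What is seen at each time: the position of the chain in `{0, …, N}` and an additional
independent observation in `E`. -/
abbrev Obs (N : ℕ) (E : Type*) := Fin (N + 1) × E

abbrev Path (N : ℕ) (E : Type*) := ℕ → Obs N E

section Paths

variable {N : ℕ} {E : Type*}

/-- The position `X_t`. -/
def position (t : ℕ) (ω : Path N E) : ℕ := ((ω t).1 : ℕ)

/-- The running maximum `M_t = max (X_0, …, X_t)`. -/
def runMax (t : ℕ) (ω : Path N E) : ℕ := (Finset.range (t + 1)).sup fun u => position u ω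

/-- The first time at which the chain is at `y` (`⊤` if there is none). -/
noncomputable def hit (y : ℕ) (ω : Path N E) : ℕ∞ :=
  ⨅ (n : ℕ) (_ : position n ω = y), (n : ℕ∞)

/-- The shuttle time `S`: the first time after `hit N` at which the chain is at `0`. -/
noncomputable def shuttle (ω : Path N E) : ℕ∞ :=
  ⨅ (n : ℕ) (_ : hit N ω < (n : ℕ∞) ∧ position n ω = 0), (n : ℕ∞)

open scoped Classical in
/-- The total cost `∑_{t = 0}^{S - 1} f (X_t)`, with values in `[0, ∞]`. -/
noncomputable def shuttleCost (f : ℕ → ℝ) (ω : Path N E) : ℝ≥0∞ :=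
  ∑' t : ℕ, if (t : ℕ∞) < shuttle ω then ENNReal.ofReal (f (position t ω)) else 0

end Paths

/-- The filtration `(F_t)` generated by the observations up to time `t`. -/
abbrev history (N : ℕ) (E : Type*) [MeasurableSpace E] :
    Filtration ℕ (MeasurableSpace.pi : MeasurableSpace (Path N E)) :=
  Filtration.piLE (X := fun _ : ℕ => Obs N E)

/-- An adapted random scale function, i.e. a control. `W k` is the increment `s (k + 1) - s k`,
positive, with `W 0 = 1`. It may be random, but it is known at every time at which the level `k`
has been reached. Only the values `W k` with `k < N` matter. -/
structure RandomScale (N : ℕ) (E : Type*) [MeasurableSpace E] where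
  W : ℕ → Path N E → ℝ
  measurable_W : ∀ k, Measurable (W k)
  W_pos : ∀ k ω, 0 < W k ω
  W_zero : ∀ ω, W 0 ω = 1
  adapted : ∀ k t, Measurable[history N E t] ({ω | k ≤ runMax t ω}.indicator (W k))

/-- `(f n + f (n + 1)) / 2`. -/
noncomputable def avg (f : ℕ → ℝ) (n : ℕ) : ℝ := (f n + f (n + 1)) / 2

/-- The explicit formula for the expected cost `φ_y x` of going from `x` to `y`, for the chain on
`{0, …, N}` with scale increments `w`. -/
noncomputable def phi (N : ℕ) (f w : ℕ → ℝ) (y x : ℕ) : ℝ :=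
  if x ≤ y then
    ∑ v ∈ Finset.Ico x y, f v
      + ∑ v ∈ Finset.Ico x y, ∑ u ∈ Finset.range v, 2 * avg f u * w v / w u
  else
    ∑ v ∈ Finset.Ioc y x, f v
      + ∑ v ∈ Finset.Ico y x, ∑ u ∈ Finset.Ico (v + 1) N, 2 * avg f u * w v / w u

namespace RandomScale

variable {N : ℕ} {E : Type*} [MeasurableSpace E]

/-- `s y = W 0 + … + W (y - 1)`, the `ds`-mass of `{0, …, y - 1}`. -/
noncomputable def scale (s : RandomScale N E) (y : ℕ) (ω : Path N E) : ℝ :=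
  ∑ k ∈ Finset.range y, s.W k ω

/-- `I^s {0, …, y - 1}`. -/
noncomputable def speed (s : RandomScale N E) (f : ℕ → ℝ) (y : ℕ) (ω : Path N E) : ℝ :=
  ∑ k ∈ Finset.range y, 2 * avg f k / s.W k ω

/-- The probability of a step up at time `t`: if `X_t = x` with `0 < x < N` it is
`p_x = 1 / (1 + w_x)`, where `w_x = q_x / p_x = W x / W (x - 1)`; moreover `p_0 = 1`, `p_N = 0`. -/
noncomputable def upProb (s : RandomScale N E) (t : ℕ) (ω : Path N E) : ℝ :=
  if position t ω = 0 then 1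
  else if position t ω = N then 0
  else 1 / (1 + s.W (position t ω) ω / s.W (position t ω - 1) ω)

/-- Extension of a finite history to a path which stays constant. Quantities that are known at
time `t` are functions of the history; they are evaluated at any extension of it. -/
def extend {t : ℕ} (h : (i : Finset.Iic t) → Obs N E) : Path N E :=
  fun n => h ⟨min n t, Finset.mem_Iic.2 (min_le_right n t)⟩

/-- One step up; truncated at `N`, where steps up have probability `0`. -/
def stepUp (x : Fin (N + 1)) : Fin (N + 1) := ⟨min (x + 1) N, by omega⟩

/-- One step down; truncated at `0`, where steps down have probability `0`. -/
def stepDown (x : Fin (N + 1)) : Fin (N + 1) := ⟨x - 1, by omega⟩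

theorem measurable_extend {t : ℕ} :
    Measurable (extend : ((i : Finset.Iic t) → Obs N E) → Path N E) :=
  measurable_pi_lambda _ fun _ => measurable_pi_apply _

theorem measurable_position (t : ℕ) : Measurable (position t : Path N E → ℕ) :=
  (measurable_of_finite (fun x : Fin (N + 1) => (x : ℕ))).comp
    (measurable_fst.comp (measurable_pi_apply t))

theorem measurable_W_position (s : RandomScale N E) (t : ℕ) (g : ℕ → ℕ) :
    Measurable fun ω : Path N E => s.W (g (position t ω)) ω := by
  have h : Measurable fun p : ℕ × Path N E => s.W p.1 p.2 :=
    measurable_from_prod_countable_right fun k => s.measurable_W k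
  exact h.comp (((measurable_of_countable g).comp (measurable_position t)).prodMk measurable_id)

theorem measurable_upProb (s : RandomScale N E) (t : ℕ) : Measurable (s.upProb t) := by
  unfold upProb
  refine Measurable.ite (measurable_position t (measurableSet_singleton 0)) measurable_const
    (Measurable.ite (measurable_position t (measurableSet_singleton N)) measurable_const ?_)
  exact measurable_const.div (measurable_const.add
    ((measurable_W_position s t id).div (measurable_W_position s t fun x => x - 1)))

theorem upProb_mem (s : RandomScale N E) (t : ℕ) (ω : Path N E) :
    0 ≤ s.upProb t ω ∧ s.upProb t ω ≤ 1 := by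
  unfold upProb
  split_ifs
  · simp
  · simp
  · have h : 0 < s.W (position t ω) ω / s.W (position t ω - 1) ω :=
      div_pos (s.W_pos _ _) (s.W_pos _ _)
    exact ⟨by positivity, by rw [div_le_one (by positivity)]; linarith⟩

/-- Given the history up to time `t`, the chain moves up with probability `upProb` and down
otherwise, and an independent observation with law `ν` is made. -/
noncomputable def kernel (s : RandomScale N E) (ν : Measure E) [IsProbabilityMeasure ν] (t : ℕ) :
    Kernel ((i : Finset.Iic t) → Obs N E) (Obs N E) where
  toFun h :=
    (ENNReal.ofReal (s.upProb t (extend h)) •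
        Measure.dirac (stepUp (extend h t).1)
      + ENNReal.ofReal (1 - s.upProb t (extend h)) •
        Measure.dirac (stepDown (extend h t).1)).prod ν
  measurable' := by
    have key : ∀ g : Fin (N + 1) → Fin (N + 1), Measurable
        fun h : (i : Finset.Iic t) → Obs N E =>
          (Measure.dirac (g (extend h t).1)).prod ν := fun g => by
      have h1 : Measurable fun x : Fin (N + 1) => (Measure.dirac (g x)).prod ν :=
        measurable_of_finite _
      exact h1.comp (measurable_fst.comp ((measurable_pi_apply t).comp measurable_extend))
    have hp : Measurable fun h : (i : Finset.Iic t) → Obs N E => s.upProb t (extend h) :=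
      (s.measurable_upProb t).comp measurable_extend
    refine Measure.measurable_of_measurable_coe _ fun B hB => ?_
    simp only [Measure.add_prod, Measure.prod_smul_left, Measure.add_apply, Measure.smul_apply,
      smul_eq_mul]
    exact (hp.ennreal_ofReal.mul ((Measure.measurable_coe hB).comp (key stepUp))).add
      ((measurable_const.sub hp).ennreal_ofReal.mul
        ((Measure.measurable_coe hB).comp (key stepDown)))

instance (s : RandomScale N E) (ν : Measure E) [IsProbabilityMeasure ν] (t : ℕ) :
    IsMarkovKernel (s.kernel ν t) := by
  refine ⟨fun h => ⟨?_⟩⟩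
  have hp := s.upProb_mem t (extend h)
  change ((_ • _ + _ • _ : Measure (Fin (N + 1))).prod ν) Set.univ = 1
  rw [← Set.univ_prod_univ, Measure.prod_prod]
  simp only [Measure.add_apply, Measure.smul_apply, measure_univ, smul_eq_mul, mul_one]
  rw [← ENNReal.ofReal_add hp.1 (by linarith [hp.2])]
  simp

/-- The law of the controlled chain, started at `0`. -/
noncomputable def law (s : RandomScale N E) (ν : Measure E) [IsProbabilityMeasure ν] :
    Measure (Path N E) :=
  Kernel.trajMeasure (X := fun _ : ℕ => Obs N E) ((Measure.dirac 0).prod ν) (s.kernel ν)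

/-- The controls whose increments agree with those of `s₀` on `{0, …, y - 1}`. -/
def constrained (s₀ : RandomScale N E) (y : ℕ) : Set (RandomScale N E) :=
  {s | ∀ k < y, s.W k = s₀.W k}

/-- The conditional expected cost `E [∑_{u < S} f (X^s_u) | F_t]` under the control `s`. -/
noncomputable def condCost (s : RandomScale N E) (ν : Measure E) [IsProbabilityMeasure ν]
    (f : ℕ → ℝ) (t : ℕ) : Path N E → ℝ≥0∞ :=
  condLExp (history N E t) (s.law ν) (shuttleCost f)

/-- The explicit candidate `v_t`. -/
noncomputable def candidate (s₀ : RandomScale N E) (f : ℕ → ℝ) (t : ℕ) (ω : Path N E) : ℝ :=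
  if runMax t ω < N then
    ∑ u ∈ Finset.range t, f (position u ω)
      + (√(s₀.scale (runMax t ω) ω * s₀.speed f (runMax t ω) ω)
          + ∑ k ∈ Finset.Ico (runMax t ω) N, √(2 * avg f k)) ^ 2
      - phi N f (fun k => s₀.W k ω) (position t ω) 0
  else
    ∑ u ∈ Finset.range (min (t : ℕ∞) (shuttle ω)).toNat, f (position u ω)
      + phi N f (fun k => s₀.W k ω) 0 (position (min (t : ℕ∞) (shuttle ω)).toNat ω)

end RandomScale

/-- `g` is (a version of) the essential infimum under `μ` of the functions `G i`, `i ∈ A`. -/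
def IsEssInf {Ω ι : Type*} [MeasurableSpace Ω] (μ : Measure Ω) (A : Set ι)
    (G : ι → Ω → ℝ≥0∞) (g : Ω → ℝ≥0∞) : Prop :=
  AEMeasurable g μ ∧ (∀ i ∈ A, g ≤ᵐ[μ] G i) ∧
    ∀ h : Ω → ℝ≥0∞, AEMeasurable h μ → (∀ i ∈ A, h ≤ᵐ[μ] G i) → h ≤ᵐ[μ] g

/-- `V` is the optimal payoff process of `s₀`: on the event `M_t = y`, the random variable `V t` is
the essential infimum of the conditional expected cost given `F_t` over the controls which agree
with `s₀` on `{0, …, y - 1}`. -/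
def IsBellmanProcess {N : ℕ} {E : Type*} [MeasurableSpace E] (ν : Measure E)
    [IsProbabilityMeasure ν] (f : ℕ → ℝ) (s₀ : RandomScale N E)
    (V : ℕ → Path N E → ℝ≥0∞) : Prop :=
  ∀ t y : ℕ, IsEssInf ((s₀.law ν).restrict {ω | runMax t ω = y}) (s₀.constrained y)
    (fun s => s.condCost ν f t) (V t)

end BirthDeath

/-!
For fixed increments `w`, the expected cost of going from `0` to `N` and back is `s(N) I(N)`, where
`s` is the scale and `I` the speed sum (`phi_add_phi`). If the increments below the level `m` are
given and the others are free, the Cauchy–Schwarz inequality shows that the least value of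
`s(N) I(N)` is `(√(s(m) I(m)) + J([m, N)))²` (`optTotal`); it does not decrease when one more
increment is fixed (`optTotal_le_succ`), and it stays constant if the further increments are
proportional to `√(2 f̃)` (`optTotal_eq_of_optimal`). Subtracting the cost `φ_x(0)` of getting from
`0` to the present position `x` gives the cost to come, `remCost`.

The conditional expected cost of a control given the history up to time `t` is the cost incurred so
far plus `value`, an integral over the future after time `t` (`condCost_ae_eq`). Since the
transition kernels of any two controls are equivalent, this version is valid almost surely under the
law of `s₀` as well, and everything else is an inequality that holds for *every* path. By first step
analysis, `value` satisfies `value = f + p · (average of value after a step up)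
+ (1 - p) · (average of value after a step down)` (`value_eq`).

*Lower bound* (`ofReal_remaining_le_value`). While the running maximum stays at `m`, the increments
up to the level `m` do not change. So the infimum of `value` over all histories with these
increments, as a function of the position, is a superharmonic function of a birth-death chain on
`{0, …, m}`, and it pays at least `φ_{x+1}(x)` for each climb from `x` to `x + 1`
(`add_upCost_le_of_superharmonic`). The bound at `m + 1` comes from the next value of the running
maximum, so the argument is a descending induction on `m`; it starts at `m = N` with the way back
to `0`. No integrability is needed, as the functions have values in `[0, ∞]`, and no limit in time.

*Upper bound* (`valueUpTo_le_ofReal_remaining`). For the control with optimal increments, `remCost`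
satisfies the one-step equation exactly (`remCost_step`) and is nonnegative. By induction on `n` it
therefore dominates the expected cost over the next `n` steps, and `value` is the supremum of these.
-/

namespace BirthDeath

/-! ### Conditional expectations under the Ionescu-Tulcea measure -/

section Trajectories

open Finset Preorder

variable {X : ℕ → Type*} [∀ n, MeasurableSpace (X n)]

theorem measurable_piLE_iff_exists {t : ℕ} {s : Set (∀ n, X n)} :
    MeasurableSet[Filtration.piLE (X := X) t] s ↔
      ∃ A, MeasurableSet A ∧ frestrictLe t ⁻¹' A = s := by
  rw [Filtration.piLE_eq_comap_frestrictLe]; rfl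

variable (κ : (n : ℕ) → Kernel ((i : Iic n) → X i) (X (n + 1))) [∀ n, IsMarkovKernel (κ n)]

/-- First step analysis: to integrate over the future after time `a`, integrate over the future
after time `a + 1` and then over the next coordinate. -/
theorem lintegral_traj_eq_lintegral_succ (a : ℕ) (ω : ∀ n, X n) {F : (∀ n, X n) → ℝ≥0∞}
    (hF : Measurable F) :
    ∫⁻ x, F x ∂Kernel.traj κ a (frestrictLe a ω) =
      ∫⁻ z, ∫⁻ x, F x ∂Kernel.traj κ (a + 1) (frestrictLe (a + 1) (Function.update ω (a + 1) z))
        ∂κ a (frestrictLe a ω) := by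
  have hG : Measurable fun h => ∫⁻ x, F x ∂Kernel.traj κ (a + 1) h := hF.lintegral_kernel
  have hG' : Measurable fun x : ∀ n, X n =>
      ∫⁻ y, F y ∂Kernel.traj κ (a + 1) (frestrictLe (a + 1) x) :=
    hG.comp (measurable_frestrictLe _)
  refine Eq.trans ?_ (Kernel.lmarginalPartialTraj_succ (κ := κ) a hG' ω)
  have hz : ∀ z : (i : Iic (a + 1)) → X i,
      frestrictLe (a + 1) (Function.updateFinset ω (Iic (a + 1)) z) = z := fun z => by
    ext i
    simp [Function.updateFinset]
  simp only [Kernel.lmarginalPartialTraj, hz]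
  rw [← Kernel.traj_comp_partialTraj (κ := κ) a.le_succ, Kernel.lintegral_comp _ _ _ hF]

/-- Under the law of the future after time `a`, a summand known at time `a` is a constant. -/
theorem lintegral_traj_add_of_dependsOn (a : ℕ) (ω : ∀ n, X n) {G H : (∀ n, X n) → ℝ≥0∞}
    (hG : Measurable G)
    (hdep : ∀ x y : ∀ n, X n, (∀ i ≤ a, x i = y i) → G x = G y) :
    ∫⁻ x, (G x + H x) ∂Kernel.traj κ a (frestrictLe a ω) =
      G ω + ∫⁻ x, H x ∂Kernel.traj κ a (frestrictLe a ω) := by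
  rw [lintegral_add_left hG, Kernel.lintegral_traj _ hG]
  congr 1
  have : ∀ x, G (Function.updateFinset x (Iic a) (frestrictLe a ω)) = G ω := fun x =>
    hdep _ _ fun i hi => by simp [Function.updateFinset, hi]
  simp [this]

variable (μ₀ : Measure (X 0))

theorem lintegral_trajMeasure_eq_lintegral_traj (t : ℕ) {F : (∀ n, X n) → ℝ≥0∞}
    (hF : Measurable F) :
    ∫⁻ ω, ∫⁻ x, F x ∂Kernel.traj κ t (frestrictLe t ω) ∂Kernel.trajMeasure μ₀ κ =
      ∫⁻ ω, F ω ∂Kernel.trajMeasure μ₀ κ := by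
  have hG : Measurable fun h => ∫⁻ x, F x ∂Kernel.traj κ t h := hF.lintegral_kernel
  have hG' : Measurable fun ω : ∀ n, X n => ∫⁻ x, F x ∂Kernel.traj κ t (frestrictLe t ω) :=
    hG.comp (measurable_frestrictLe _)
  refine (Measure.lintegral_bind (Kernel.aemeasurable _) hG'.aemeasurable).trans
    (Eq.trans ?_ (Measure.lintegral_bind (Kernel.aemeasurable _) hF.aemeasurable).symm)
  refine lintegral_congr fun h => ?_
  rw [← Kernel.traj_comp_partialTraj (κ := κ) (Nat.zero_le t), Kernel.lintegral_comp _ _ _ hF,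
    Kernel.traj_comp_partialTraj (Nat.zero_le t), ← Kernel.traj_map_frestrictLe_apply,
    lintegral_map hG (measurable_frestrictLe t)]

/-- The conditional expectation given the first `t` coordinates is the integral over the future
after time `t`. -/
theorem condLExp_trajMeasure [IsProbabilityMeasure μ₀] (t : ℕ) {F : (∀ n, X n) → ℝ≥0∞}
    (hF : Measurable F) :
    condLExp (Filtration.piLE (X := X) t) (Kernel.trajMeasure μ₀ κ) F
      =ᵐ[Kernel.trajMeasure μ₀ κ] fun ω => ∫⁻ x, F x ∂Kernel.traj κ t (frestrictLe t ω) := by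
  have hG : Measurable fun h => ∫⁻ x, F x ∂Kernel.traj κ t h := hF.lintegral_kernel
  refine (ae_eq_condLExp (Filtration.le _ t) _ _ ?_ ?_).symm
  · rw [Filtration.piLE_eq_comap_frestrictLe]
    exact hG.comp (comap_measurable _)
  intro s hs
  have hs' := Filtration.le (Filtration.piLE (X := X)) t s hs
  obtain ⟨A, hA, rfl⟩ := measurable_piLE_iff_exists.1 hs
  rw [← lintegral_indicator hs', ← lintegral_indicator hs',
    ← lintegral_trajMeasure_eq_lintegral_traj κ μ₀ t (hF.indicator hs')]
  congr with ω
  rw [Kernel.lintegral_traj _ (hF.indicator hs')]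
  have : ∀ x, frestrictLe t (Function.updateFinset x (Iic t) (frestrictLe t ω))
      = frestrictLe t ω := fun x => by
    ext i; simp [Function.updateFinset]
  by_cases h : frestrictLe t ω ∈ A
  · simp only [Set.indicator, Set.mem_preimage, this, h, if_true]
    rw [Kernel.lintegral_traj _ hF]
  · simp [Set.indicator, this, h]

/-- If the transition kernels `κ n` are absolutely continuous with respect to `η n`, so are the laws
of the trajectories up to a finite time. On infinite trajectories this fails in general. -/
theorem trajMeasure_map_frestrictLe_absolutelyContinuous [IsProbabilityMeasure μ₀]
    (η : (n : ℕ) → Kernel ((i : Iic n) → X i) (X (n + 1))) [∀ n, IsMarkovKernel (η n)]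
    (hκη : ∀ n h, κ n h ≪ η n h) (t : ℕ) :
    (Kernel.trajMeasure μ₀ κ).map (frestrictLe t) ≪
      (Kernel.trajMeasure μ₀ η).map (frestrictLe t) := by
  induction t with
  | zero =>
    refine (le_of_eq ?_ : _ ≤ _).absolutelyContinuous
    simp only [Kernel.trajMeasure]
    rw [Measure.map_comp _ _ (by fun_prop), Measure.map_comp _ _ (by fun_prop),
      Kernel.traj_map_frestrictLe, Kernel.traj_map_frestrictLe]
    simp
  | succ t ih =>
    have h := ih.compProd (κ := κ t) (η := η t) (Filter.Eventually.of_forall (hκη t))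
    rw [Kernel.map_frestrictLe_trajMeasure_compProd_eq_map_trajMeasure,
      Kernel.map_frestrictLe_trajMeasure_compProd_eq_map_trajMeasure] at h
    have hm : Measurable fun p : ((i : Iic t) → X i) × X (t + 1) =>
        IicProdIoc t (t + 1) (p.1, MeasurableEquiv.piSingleton t p.2) := by fun_prop
    have h2 := h.map hm
    rw [Measure.map_map hm (by fun_prop), Measure.map_map hm (by fun_prop)] at h2
    convert! h2 using 2 <;>
    · ext x i
      by_cases hi : (i : ℕ) ≤ t
      · simp [IicProdIoc, hi]
      · have : (i : ℕ) = t + 1 := le_antisymm (mem_Iic.1 i.2) (by omega)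
        obtain ⟨i, hi'⟩ := i
        simp only at this
        subst this
        simp [IicProdIoc, MeasurableEquiv.piSingleton]

end Trajectories

/-! ### Passage costs, the optimal cost, and minimum principles for fixed increments -/

section Deterministic

variable {N : ℕ} {f w w' : ℕ → ℝ}

/-- The least expected total cost, seen from the start, when the increments below the level `m` are
`w` and the others are still free: `(√(s(m) I(m)) + J([m, N)))²`. -/
noncomputable def optTotal (N : ℕ) (f w : ℕ → ℝ) (m : ℕ) : ℝ :=
  (√((∑ k ∈ Finset.range m, w k) * ∑ k ∈ Finset.range m, 2 * avg f k / w k)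
    + ∑ k ∈ Finset.Ico m N, √(2 * avg f k)) ^ 2

/-- The cost still to come when the chain is at `x` and its running maximum is `m`, under an optimal
choice of the increments from the level `m` on. -/
noncomputable def remCost (N : ℕ) (f w : ℕ → ℝ) (m x : ℕ) : ℝ :=
  if m < N then optTotal N f w m - phi N f w x 0 else phi N f w 0 x

/-- The expected cost `φ_{x+1}(x)` of the first passage from `x` to `x + 1`. -/
noncomputable def upCost (f w : ℕ → ℝ) (x : ℕ) : ℝ :=
  f x + ∑ u ∈ Finset.range x, 2 * avg f u * w x / w u

/-- The expected cost `φ_x(x+1)` of the first passage from `x + 1` to `x`. -/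
noncomputable def downCost (N : ℕ) (f w : ℕ → ℝ) (x : ℕ) : ℝ :=
  f (x + 1) + ∑ u ∈ Finset.Ico (x + 1) N, 2 * avg f u * w x / w u

theorem avg_pos (hf : ∀ n ≤ N, 0 < f n) {k : ℕ} (hk : k < N) : 0 < avg f k := by
  have h1 := hf k hk.le
  have h2 := hf (k + 1) hk
  unfold avg; linarith

@[simp] theorem phi_zero_zero : phi N f w 0 0 = 0 := by simp [phi]

theorem phi_succ_zero (x : ℕ) : phi N f w (x + 1) 0 = phi N f w x 0 + upCost f w x := by
  simp only [phi, upCost, Nat.zero_le, if_true, Nat.Ico_zero_eq_range, Finset.sum_range_succ]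
  ring

theorem phi_zero_succ (x : ℕ) : phi N f w 0 (x + 1) = phi N f w 0 x + downCost N f w x := by
  rcases Nat.eq_zero_or_pos x with rfl | hx
  · simp [phi, downCost]
  · simp only [phi, downCost, Nat.le_zero, hx.ne', Nat.succ_ne_zero, if_false,
      Nat.Ico_zero_eq_range, Finset.sum_range_succ]
    rw [← Finset.sum_Ioc_consecutive f (Nat.zero_le x) x.le_succ]
    simp
    ring

theorem upCost_zero : upCost f w 0 = f 0 := by simp [upCost]

theorem downCost_last (hN : 1 ≤ N) : downCost N f w (N - 1) = f N := by
  simp [downCost, Nat.sub_add_cancel hN]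

theorem upCost_succ (hw : ∀ k, 0 < w k) (x : ℕ) :
    upCost f w (x + 1) =
      (1 + w (x + 1) / w x) * f (x + 1) + w (x + 1) / w x * upCost f w x := by
  have h : ∑ u ∈ Finset.range x, 2 * avg f u * w (x + 1) / w u
      = w (x + 1) / w x * ∑ u ∈ Finset.range x, 2 * avg f u * w x / w u := by
    rw [Finset.mul_sum]
    refine Finset.sum_congr rfl fun u _ => ?_
    have := (hw u).ne'; have := (hw x).ne'
    field_simp
  have := (hw x).ne'
  rw [upCost, upCost, Finset.sum_range_succ, h, avg]
  field_simp
  ring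

theorem downCost_eq (hw : ∀ k, 0 < w k) {x : ℕ} (hx : x + 1 < N) :
    downCost N f w x =
      (1 + w x / w (x + 1)) * f (x + 1) + w x / w (x + 1) * downCost N f w (x + 1) := by
  have h : ∑ u ∈ Finset.Ico (x + 1 + 1) N, 2 * avg f u * w x / w u
      = w x / w (x + 1) * ∑ u ∈ Finset.Ico (x + 1 + 1) N, 2 * avg f u * w (x + 1) / w u := by
    rw [Finset.mul_sum]
    refine Finset.sum_congr rfl fun u _ => ?_
    have := (hw u).ne'; have := (hw (x + 1)).ne'
    field_simp
  have := (hw (x + 1)).ne'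
  rw [downCost, downCost, Finset.sum_eq_sum_Ico_succ_bot hx, h, avg]
  field_simp
  ring

theorem upCost_nonneg (hf : ∀ n ≤ N, 0 < f n) (hw : ∀ k, 0 < w k) {x : ℕ} (hx : x ≤ N) :
    0 ≤ upCost f w x := by
  refine add_nonneg (hf x hx).le (Finset.sum_nonneg fun u hu => ?_)
  have h1 := avg_pos hf ((Finset.mem_range.1 hu).trans_le hx)
  have := hw u; have := hw x
  positivity

theorem downCost_nonneg (hf : ∀ n ≤ N, 0 < f n) (hw : ∀ k, 0 < w k) {x : ℕ} (hx : x < N) :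
    0 ≤ downCost N f w x := by
  refine add_nonneg (hf _ hx).le (Finset.sum_nonneg fun u hu => ?_)
  have h1 := avg_pos hf (Finset.mem_Ico.1 hu).2
  have := hw u; have := hw x
  positivity

theorem phi_left_nonneg (hf : ∀ n ≤ N, 0 < f n) (hw : ∀ k, 0 < w k) {x : ℕ} (hx : x ≤ N) :
    0 ≤ phi N f w 0 x := by
  induction x with
  | zero => simp
  | succ x ih => rw [phi_zero_succ]; linarith [ih (by omega), downCost_nonneg hf hw hx]

theorem phi_zero_mono (hf : ∀ n ≤ N, 0 < f n) (hw : ∀ k, 0 < w k) {x m : ℕ} (hxm : x ≤ m)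
    (hm : m ≤ N) : phi N f w x 0 ≤ phi N f w m 0 := by
  induction m, hxm using Nat.le_induction with
  | base => rfl
  | succ m _ ih =>
    rw [phi_succ_zero]
    linarith [ih (by omega), upCost_nonneg hf hw (show m ≤ N by omega)]

/-- The expected cost of a full shuttle is `s(N) I(N)`. -/
theorem phi_add_phi (hw : ∀ k, 0 < w k) (m : ℕ) :
    phi m f w m 0 + phi m f w 0 m =
      (∑ k ∈ Finset.range m, w k) * ∑ k ∈ Finset.range m, 2 * avg f k / w k := by
  rcases Nat.eq_zero_or_pos m with rfl | hm
  · simp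
  have hdiag : ∑ v ∈ Finset.range m, f v + ∑ v ∈ Finset.Ioc 0 m, f v
      = ∑ v ∈ Finset.range m, 2 * avg f v := by
    rw [← Finset.Ico_add_one_add_one_eq_Ioc, Finset.sum_Ico_eq_sum_range,
      show m + 1 - (0 + 1) = m by omega, ← Finset.sum_add_distrib]
    refine Finset.sum_congr rfl fun v _ => ?_
    rw [avg, show 0 + 1 + v = v + 1 by ring]; ring
  have hsplit : (∑ k ∈ Finset.range m, w k) * ∑ k ∈ Finset.range m, 2 * avg f k / w k
      = ∑ v ∈ Finset.range m, (∑ u ∈ Finset.range v, 2 * avg f u * w v / w u + 2 * avg f v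
        + ∑ u ∈ Finset.Ico (v + 1) m, 2 * avg f u * w v / w u) := by
    rw [Finset.sum_mul_sum]
    refine Finset.sum_congr rfl fun v hv => ?_
    have hv' := Finset.mem_range.1 hv
    have h1 : 2 * avg f v = 2 * avg f v * w v / w v := by
      have := (hw v).ne'; field_simp
    rw [h1, ← Finset.sum_range_succ, Finset.sum_range_add_sum_Ico _ (by omega)]
    exact Finset.sum_congr rfl fun u _ => by ring
  rw [hsplit]
  simp only [Finset.sum_add_distrib, ← hdiag]
  simp only [phi, Nat.zero_le, if_true, Nat.le_zero, hm.ne', if_false, Nat.Ico_zero_eq_range]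
  ring

theorem scale_mul_speed_nonneg (hf : ∀ n ≤ N, 0 < f n) (hw : ∀ k, 0 < w k) {m : ℕ} (hm : m ≤ N) :
    0 ≤ (∑ k ∈ Finset.range m, w k) * ∑ k ∈ Finset.range m, 2 * avg f k / w k := by
  refine mul_nonneg (Finset.sum_nonneg fun k _ => (hw k).le) (Finset.sum_nonneg fun k hk => ?_)
  have := avg_pos hf ((Finset.mem_range.1 hk).trans_le hm)
  have := hw k
  positivity

/-- The two branches of `remCost` fit together when the chain first reaches `N`. -/
theorem remCost_self (hf : ∀ n ≤ N, 0 < f n) (hw : ∀ k, 0 < w k) {m : ℕ} (hm : m ≤ N) :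
    remCost N f w m m = optTotal N f w m - phi N f w m 0 := by
  rcases hm.lt_or_eq with h | rfl
  · simp [remCost, h]
  · simp only [remCost, optTotal, lt_irrefl, if_false, Finset.Ico_self, Finset.sum_empty, add_zero]
    rw [Real.sq_sqrt (scale_mul_speed_nonneg hf hw le_rfl), ← phi_add_phi hw]
    ring

theorem remCost_nonneg (hf : ∀ n ≤ N, 0 < f n) (hw : ∀ k, 0 < w k) {m x : ℕ} (hm : m ≤ N)
    (hx : x ≤ m) : 0 ≤ remCost N f w m x := by
  unfold remCost
  split_ifs
  · have h1 := phi_zero_mono hf hw hx hm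
    have h2 : phi N f w m 0 ≤ optTotal N f w m := by
      have h3 := scale_mul_speed_nonneg hf hw hm
      have h4 : 0 ≤ ∑ k ∈ Finset.Ico m N, √(2 * avg f k) :=
        Finset.sum_nonneg fun _ _ => Real.sqrt_nonneg _
      have h5 : phi N f w m 0 = phi m f w m 0 := by simp [phi]
      have h6 := phi_add_phi (f := f) hw m
      have h7 := phi_left_nonneg (N := m) (fun n hn => hf n (hn.trans hm)) hw le_rfl
      have h8 := Real.sq_sqrt h3
      have h9 := mul_nonneg (Real.sqrt_nonneg
        ((∑ k ∈ Finset.range m, w k) * ∑ k ∈ Finset.range m, 2 * avg f k / w k)) h4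
      unfold optTotal
      nlinarith
    linarith
  · exact phi_left_nonneg hf hw (hx.trans hm)

/-- Fixing one more increment can only increase the optimal cost: this is the Cauchy–Schwarz
inequality. -/
theorem optTotal_le_succ (hf : ∀ n ≤ N, 0 < f n) (hw : ∀ k, 0 < w k) {m : ℕ} (hm : m < N) :
    optTotal N f w m ≤ optTotal N f w (m + 1) := by
  have hg := avg_pos hf hm
  have hwm := hw m
  have hs : 0 ≤ ∑ k ∈ Finset.range m, w k := Finset.sum_nonneg fun k _ => (hw k).le
  have hI : 0 ≤ ∑ k ∈ Finset.range m, 2 * avg f k / w k := Finset.sum_nonneg fun k hk => by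
    have := avg_pos hf ((Finset.mem_range.1 hk).trans hm)
    have := hw k
    positivity
  have hJ : 0 ≤ ∑ k ∈ Finset.Ico (m + 1) N, √(2 * avg f k) :=
    Finset.sum_nonneg fun _ _ => Real.sqrt_nonneg _
  unfold optTotal
  rw [Finset.sum_range_succ, Finset.sum_range_succ, Finset.sum_eq_sum_Ico_succ_bot hm, ← add_assoc]
  generalize ∑ k ∈ Finset.range m, w k = s at *
  generalize ∑ k ∈ Finset.range m, 2 * avg f k / w k = I at *
  -- Cauchy–Schwarz for the vectors `(√s, √(w m))` and `(√I, √(2 f̃(m) / w m))`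
  have key : √(s * I) + √(2 * avg f m) ≤ √((s + w m) * (I + 2 * avg f m / w m)) := by
    refine Real.le_sqrt_of_sq_le ?_
    have e1 : √(s * I) * √(2 * avg f m) = √(w m * I) * √(s * (2 * avg f m / w m)) := by
      rw [← Real.sqrt_mul (by positivity), ← Real.sqrt_mul (by positivity)]
      congr 1
      field_simp
    have e2 := two_mul_le_add_sq (√(w m * I)) (√(s * (2 * avg f m / w m)))
    rw [Real.sq_sqrt (by positivity), Real.sq_sqrt (by positivity)] at e2
    have e3 : w m * (2 * avg f m / w m) = 2 * avg f m := by field_simp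
    rw [add_sq, Real.sq_sqrt (by positivity), Real.sq_sqrt (by positivity)]
    nlinarith
  gcongr

/-- With the optimal increments from the level `y` on, the optimal cost stays constant. -/
theorem optTotal_eq_of_optimal (hf : ∀ n ≤ N, 0 < f n) (hw : ∀ k, 0 < w k) {y m : ℕ}
    (hy : 1 ≤ y) (hym : y ≤ m) (hm : m ≤ N)
    (hopt : ∀ x, y ≤ x → x < N → w x =
      √((∑ k ∈ Finset.range y, w k) / ∑ k ∈ Finset.range y, 2 * avg f k / w k)
        * √(2 * avg f x)) :
    optTotal N f w m = optTotal N f w y := by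
  set s := ∑ k ∈ Finset.range y, w k with hs_def
  set I := ∑ k ∈ Finset.range y, 2 * avg f k / w k with hI_def
  have hne : (Finset.range y).Nonempty := ⟨0, Finset.mem_range.2 hy⟩
  have hs : 0 < s := Finset.sum_pos (fun k _ => hw k) hne
  have hI : 0 < I := Finset.sum_pos (fun k hk => by
    have := avg_pos hf ((Finset.mem_range.1 hk).trans_le (hym.trans hm))
    have := hw k
    positivity) hne
  set c := √(s / I) with hc_def
  have hc : 0 < c := Real.sqrt_pos.2 (by positivity)
  have hcs : s = c ^ 2 * I := by
    rw [hc_def, Real.sq_sqrt (by positivity)]; field_simp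
  have hsm : ∀ m, y ≤ m → m ≤ N →
      ∑ k ∈ Finset.range m, w k = s + c * ∑ k ∈ Finset.Ico y m, √(2 * avg f k) := by
    intro m h1 h2
    rw [← Finset.sum_range_add_sum_Ico _ h1, Finset.mul_sum]
    congr 1
    exact Finset.sum_congr rfl fun k hk =>
      hopt k (Finset.mem_Ico.1 hk).1 ((Finset.mem_Ico.1 hk).2.trans_le h2)
  have hIm : ∀ m, y ≤ m → m ≤ N → ∑ k ∈ Finset.range m, 2 * avg f k / w k
      = I + (∑ k ∈ Finset.Ico y m, √(2 * avg f k)) / c := by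
    intro m h1 h2
    rw [← Finset.sum_range_add_sum_Ico _ h1, Finset.sum_div]
    congr 1
    refine Finset.sum_congr rfl fun k hk => ?_
    have hk' := Finset.mem_Ico.1 hk
    have ha := avg_pos hf (hk'.2.trans_le h2)
    have hr : 0 < √(2 * avg f k) := Real.sqrt_pos.2 (by positivity)
    rw [hopt k hk'.1 (hk'.2.trans_le h2), div_eq_div_iff (by positivity) hc.ne']
    nlinarith [Real.mul_self_sqrt (show 0 ≤ 2 * avg f k by positivity)]
  have hroot : ∀ m, y ≤ m → m ≤ N →
      √((∑ k ∈ Finset.range m, w k) * ∑ k ∈ Finset.range m, 2 * avg f k / w k)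
        = c * I + ∑ k ∈ Finset.Ico y m, √(2 * avg f k) := by
    intro m h1 h2
    have hJ : 0 ≤ ∑ k ∈ Finset.Ico y m, √(2 * avg f k) :=
      Finset.sum_nonneg fun _ _ => Real.sqrt_nonneg _
    rw [hsm m h1 h2, hIm m h1 h2, ← Real.sqrt_sq (show 0 ≤ c * I + _ by positivity)]
    congr 1
    rw [hcs]
    field_simp
  have h1 := hroot m hym hm
  have h2 := hroot y le_rfl (hym.trans hm)
  rw [← hs_def, ← hI_def] at h2
  rw [optTotal, optTotal, h1, ← hs_def, ← hI_def, h2, Finset.Ico_self, Finset.sum_empty, add_zero,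
    add_assoc, Finset.sum_Ico_consecutive _ hym hm]

/-- The increment at the level `0` is normalised to `1`, hence costs nothing. -/
theorem optTotal_one (hN : 1 ≤ N) (hw : w 0 = 1) :
    optTotal N f w 1 = optTotal N f w 0 := by
  rw [optTotal, optTotal, Finset.sum_eq_sum_Ico_succ_bot (show 0 < N from hN)]
  simp [hw]

/-- `remCost` uses only the increments known when the running maximum is `m`. -/
theorem remCost_congr {m x : ℕ} (hm : m ≤ N) (hx : x ≤ m) (h : ∀ k < m, w k = w' k) :
    remCost N f w m x = remCost N f w' m x := by
  unfold remCost
  split_ifs with hmN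
  · congr 1
    · unfold optTotal
      have h1 : ∑ k ∈ Finset.range m, w k = ∑ k ∈ Finset.range m, w' k :=
        Finset.sum_congr rfl fun k hk => h k (Finset.mem_range.1 hk)
      have h2 : ∑ k ∈ Finset.range m, 2 * avg f k / w k
          = ∑ k ∈ Finset.range m, 2 * avg f k / w' k :=
        Finset.sum_congr rfl fun k hk => by rw [h k (Finset.mem_range.1 hk)]
      rw [h1, h2]
    · simp only [phi, Nat.zero_le, if_true, Nat.Ico_zero_eq_range]
      congr 1
      refine Finset.sum_congr rfl fun v hv => Finset.sum_congr rfl fun u hu => ?_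
      rw [Finset.mem_range] at hu hv
      rw [h u (by omega), h v (by omega)]
  · have : m = N := by omega
    unfold phi
    split_ifs
    · congr 1
      refine Finset.sum_congr rfl fun v hv => Finset.sum_congr rfl fun u hu => ?_
      rw [Finset.mem_range] at hu
      rw [Finset.mem_Ico] at hv
      rw [h u (by omega), h v (by omega)]
    · congr 1
      refine Finset.sum_congr rfl fun v hv => Finset.sum_congr rfl fun u hu => ?_
      rw [Finset.mem_Ico] at hu hv
      rw [h u (by omega), h v (by omega)]

/-- The probability of a step up from `x`, for the scale increments `w`. -/
noncomputable def stepProb (N : ℕ) (w : ℕ → ℝ) (x : ℕ) : ℝ :=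
  if x = 0 then 1 else if x = N then 0 else 1 / (1 + w x / w (x - 1))

theorem stepProb_congr {x : ℕ} (h : ∀ k ≤ x, w k = w' k) :
    stepProb N w x = stepProb N w' x := by
  unfold stepProb
  rw [h x le_rfl, h (x - 1) (Nat.sub_le _ _)]

theorem one_sub_one_div_one_add_div {a b : ℝ} (ha : 0 < a) (hb : 0 < b) :
    1 - 1 / (1 + a / b) = 1 / (1 + b / a) := by
  field_simp
  ring

/-- While the optimal cost stays constant, `remCost` satisfies the one-step equation. The case
`x = 0`, `m = N` is excluded: the chain then has completed its shuttle. -/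
theorem remCost_step (hf : ∀ n ≤ N, 0 < f n) (hw : ∀ k, 0 < w k) {m x : ℕ}
    (hm : m ≤ N) (hx : x ≤ m) (hx0 : m = N → x ≠ 0)
    (hopt : m < N → optTotal N f w (m + 1) = optTotal N f w m) :
    remCost N f w m x = f x
      + stepProb N w x * remCost N f w (max m (min (x + 1) N)) (min (x + 1) N)
      + (1 - stepProb N w x) * remCost N f w m (x - 1) := by
  rcases hm.lt_or_eq with hmN | rfl
  · have hup : remCost N f w (max m (min (x + 1) N)) (min (x + 1) N)
        = optTotal N f w m - phi N f w (x + 1) 0 := by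
      rw [min_eq_left (by omega)]
      rcases hx.lt_or_eq with h | rfl
      · rw [max_eq_left (by omega), remCost, if_pos hmN]
      · rw [max_eq_right (by omega), remCost_self hf hw hmN, hopt hmN]
    rw [hup]
    simp only [remCost, hmN, if_true]
    rcases x with _ | x
    · rw [phi_succ_zero, upCost_zero]
      simp [stepProb]
    · have hxN : x + 1 ≠ N := by omega
      have h1 := hw x; have h2 := hw (x + 1)
      simp only [stepProb, Nat.succ_ne_zero, if_false, hxN, Nat.add_sub_cancel]
      rw [phi_succ_zero (x + 1), phi_succ_zero x, upCost_succ hw]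
      field_simp
      ring
  · obtain ⟨x, rfl⟩ := Nat.exists_eq_succ_of_ne_zero (hx0 rfl)
    rw [max_eq_left (min_le_right _ _)]
    simp only [remCost, lt_irrefl, if_false, Nat.succ_eq_add_one, Nat.add_sub_cancel]
    rcases hx.lt_or_eq with hxm | rfl
    · have h1 := hw x; have h2 := hw (x + 1)
      have hxm' : x + 1 ≠ m := by simpa using hxm.ne
      rw [min_eq_left (by omega)]
      simp only [stepProb, Nat.succ_ne_zero, if_false, hxm', Nat.add_sub_cancel]
      rw [phi_zero_succ (x + 1), phi_zero_succ x, downCost_eq hw hxm]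
      field_simp
      ring
    · have := downCost_last (N := x + 1) (f := f) (w := w) (by omega)
      simp only [Nat.add_sub_cancel] at this
      simp only [stepProb, Nat.succ_eq_add_one, Nat.succ_ne_zero, if_false, if_true]
      rw [phi_zero_succ x, this]
      ring

/-- The algebra of a first passage: a return trip of cost `A + D` entered with probability
`1 - 1 / (1 + ρ)` is solved for `A`. -/
theorem add_ofReal_le_of_step {A B C : ℝ≥0∞} {F D ρ : ℝ} (hF : 0 ≤ F) (hD : 0 ≤ D) (hρ : 0 < ρ)
    (hC : A + ENNReal.ofReal D ≤ C)
    (h : ENNReal.ofReal F + ENNReal.ofReal (1 / (1 + ρ)) * B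
      + ENNReal.ofReal (1 - 1 / (1 + ρ)) * C ≤ A) :
    B + ENNReal.ofReal ((1 + ρ) * F + ρ * D) ≤ A := by
  replace h := (add_le_add_right (mul_le_mul_right hC _) _).trans h
  rcases eq_or_ne A ⊤ with rfl | hA
  · exact le_top
  have hp : 0 < 1 / (1 + ρ) := by positivity
  have hq : 0 ≤ 1 - 1 / (1 + ρ) := by
    rw [sub_nonneg, div_le_one (by positivity)]; linarith
  have hB : B ≠ ⊤ := by
    rintro rfl
    rw [ENNReal.mul_top (by simpa using hp)] at h
    simp at h
    exact hA h
  lift A to NNReal using hA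
  lift B to NNReal using hB
  rw [← ENNReal.ofReal_coe_nnreal (p := A), ← ENNReal.ofReal_coe_nnreal (p := B)] at h ⊢
  have hA0 := A.coe_nonneg
  have hB0 := B.coe_nonneg
  rw [← ENNReal.ofReal_add hA0 hD, ← ENNReal.ofReal_mul hp.le, ← ENNReal.ofReal_mul hq,
    ← ENNReal.ofReal_add hF (by positivity), ← ENNReal.ofReal_add (by positivity) (by positivity),
    ENNReal.ofReal_le_ofReal_iff hA0] at h
  rw [← ENNReal.ofReal_add hB0 (by positivity)]
  refine ENNReal.ofReal_le_ofReal ?_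
  field_simp at h
  nlinarith

/-- A minimum principle below the level `y`: a superharmonic function pays at least `upCost` for
each level it climbs. -/
theorem add_upCost_le_of_superharmonic (hf : ∀ n ≤ N, 0 < f n) (hw : ∀ k, 0 < w k) {y : ℕ}
    (hy : y < N) {a : ℕ → ℝ≥0∞}
    (h : ∀ x ≤ y, ENNReal.ofReal (f x) + ENNReal.ofReal (stepProb N w x) * a (x + 1)
      + ENNReal.ofReal (1 - stepProb N w x) * a (x - 1) ≤ a x) :
    ∀ x ≤ y, a (x + 1) + ENNReal.ofReal (upCost f w x) ≤ a x := by
  intro x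
  induction x with
  | zero =>
    intro hx
    simpa [stepProb, upCost_zero, add_comm] using h 0 hx
  | succ x ih =>
    intro hx
    have h1 := h (x + 1) hx
    simp only [stepProb, Nat.succ_ne_zero, if_false, show x + 1 ≠ N by omega,
      Nat.add_sub_cancel] at h1
    rw [upCost_succ hw]
    exact add_ofReal_le_of_step (hf _ (by omega)).le (upCost_nonneg hf hw (by omega))
      (div_pos (hw _) (hw _)) (ih (by omega)) h1

/-- The minimum principle for the way back from `N` to `0`. -/
theorem add_downCost_le_of_superharmonic (hN : 1 ≤ N) (hf : ∀ n ≤ N, 0 < f n)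
    (hw : ∀ k, 0 < w k) {a : ℕ → ℝ≥0∞}
    (h : ∀ x ≤ N, x ≠ 0 → ENNReal.ofReal (f x) + ENNReal.ofReal (stepProb N w x) * a (min (x + 1) N)
      + ENNReal.ofReal (1 - stepProb N w x) * a (x - 1) ≤ a x) :
    ∀ x < N, a x + ENNReal.ofReal (downCost N f w x) ≤ a (x + 1) := by
  suffices H : ∀ x ≤ N - 1, a x + ENNReal.ofReal (downCost N f w x) ≤ a (x + 1) from
    fun x hx => H x (by omega)
  intro x hx
  induction hx using Nat.decreasingInduction with
  | self =>
    have h1 := h N le_rfl (by omega)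
    simp only [stepProb, show N ≠ 0 by omega, if_false, if_true] at h1
    rw [downCost_last hN, Nat.sub_add_cancel hN]
    simpa [add_comm] using h1
  | of_succ x hxN ih =>
    have h1 := h (x + 1) (by omega) (by omega)
    rw [min_eq_left (by omega)] at h1
    simp only [stepProb, Nat.succ_ne_zero, if_false, show x + 1 ≠ N by omega,
      Nat.add_sub_cancel] at h1
    rw [downCost_eq hw (by omega)]
    refine add_ofReal_le_of_step (hf _ (by omega)).le (downCost_nonneg hf hw (by omega))
      (div_pos (hw _) (hw _)) ih ?_
    rw [← one_sub_one_div_one_add_div (hw (x + 1)) (hw x), sub_sub_cancel]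
    rwa [add_right_comm]

/-- A lower bound at `y + 1` spreads to all positions below: the climb from `x` costs
`φ_{y+1}(0) - φ_x(0)`. -/
theorem ofReal_sub_phi_le_of_superharmonic (hf : ∀ n ≤ N, 0 < f n) (hw : ∀ k, 0 < w k) {y : ℕ}
    (hy : y < N) {a : ℕ → ℝ≥0∞} {K : ℝ}
    (hend : ENNReal.ofReal (K - phi N f w (y + 1) 0) ≤ a (y + 1))
    (h : ∀ x ≤ y, ENNReal.ofReal (f x) + ENNReal.ofReal (stepProb N w x) * a (x + 1)
      + ENNReal.ofReal (1 - stepProb N w x) * a (x - 1) ≤ a x) {x : ℕ} (hx : x ≤ y + 1) :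
    ENNReal.ofReal (K - phi N f w x 0) ≤ a x := by
  induction hx using Nat.decreasingInduction with
  | self => exact hend
  | of_succ x hx ih =>
    calc ENNReal.ofReal (K - phi N f w x 0)
        = ENNReal.ofReal (K - phi N f w (x + 1) 0 + upCost f w x) := by
          rw [phi_succ_zero]; congr 1; ring
      _ ≤ a (x + 1) + ENNReal.ofReal (upCost f w x) :=
          ENNReal.ofReal_add_le.trans (by gcongr)
      _ ≤ a x := add_upCost_le_of_superharmonic hf hw hy h x (by omega)

theorem ofReal_phi_le_of_superharmonic (hN : 1 ≤ N) (hf : ∀ n ≤ N, 0 < f n)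
    (hw : ∀ k, 0 < w k) {a : ℕ → ℝ≥0∞}
    (h : ∀ x ≤ N, x ≠ 0 → ENNReal.ofReal (f x) + ENNReal.ofReal (stepProb N w x) * a (min (x + 1) N)
      + ENNReal.ofReal (1 - stepProb N w x) * a (x - 1) ≤ a x) {x : ℕ} (hx : x ≤ N) :
    ENNReal.ofReal (phi N f w 0 x) ≤ a x := by
  induction x with
  | zero => simp
  | succ x ih =>
    rw [phi_zero_succ]
    refine ENNReal.ofReal_add_le.trans (le_trans ?_
      (add_downCost_le_of_superharmonic hN hf hw h x hx))
    gcongr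
    exact ih (by omega)

end Deterministic

/-! ### Running maximum and shuttle time along a path -/

section PathLemmas

variable {N : ℕ} {E : Type*} {t : ℕ} {ω ω' : Path N E}

theorem position_le (t : ℕ) (ω : Path N E) : position t ω ≤ N := Nat.le_of_lt_succ (ω t).1.2

theorem position_congr {u : ℕ} (h : ∀ i ≤ t, ω i = ω' i) (hu : u ≤ t) :
    position u ω = position u ω' := by
  rw [position, position, h u hu]

theorem position_le_runMax {u : ℕ} (hu : u ≤ t) : position u ω ≤ runMax t ω :=
  Finset.le_sup (f := fun u => position u ω) (Finset.mem_range.2 (Nat.lt_succ_of_le hu))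

theorem runMax_le (t : ℕ) (ω : Path N E) : runMax t ω ≤ N :=
  Finset.sup_le fun u _ => position_le u ω

theorem exists_position_eq_runMax (t : ℕ) (ω : Path N E) : ∃ u ≤ t, position u ω = runMax t ω := by
  obtain ⟨u, hu, h⟩ := Finset.exists_mem_eq_sup (Finset.range (t + 1)) ⟨0, by simp⟩
    fun u => position u ω
  exact ⟨u, Nat.lt_succ_iff.1 (Finset.mem_range.1 hu), h.symm⟩

theorem runMax_congr (h : ∀ i ≤ t, ω i = ω' i) : runMax t ω = runMax t ω' :=
  Finset.sup_congr rfl fun _ hu => position_congr h (Nat.lt_succ_iff.1 (Finset.mem_range.1 hu))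

theorem runMax_succ : runMax (t + 1) ω = max (runMax t ω) (position (t + 1) ω) := by
  rw [runMax, Finset.range_add_one, Finset.sup_insert, max_comm]; rfl

theorem lt_shuttle_iff : (t : ℕ∞) < shuttle ω ↔
    ∀ m n, m < n → n ≤ t → position m ω = N → position n ω ≠ 0 := by
  rw [← not_iff_not]
  push Not
  have hhit : ∀ n : ℕ, hit N ω < n ↔ ∃ m < n, position m ω = N := fun n => by
    simp only [hit, iInf_lt_iff, Nat.cast_lt, exists_prop]
    exact exists_congr fun m => and_comm
  constructor
  · intro h
    have h' : shuttle ω < (t + 1 : ℕ) := h.trans_lt (by exact_mod_cast t.lt_succ_self)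
    simp only [shuttle, iInf_lt_iff, exists_prop, Nat.cast_lt, hhit] at h'
    obtain ⟨n, ⟨⟨m, hm, h1⟩, h2⟩, hn⟩ := h'
    exact ⟨m, n, hm, by omega, h1, h2⟩
  · rintro ⟨m, n, hm, hn, h1, h2⟩
    refine (iInf₂_le n ⟨(hhit n).2 ⟨m, hm, h1⟩, h2⟩).trans ?_
    exact_mod_cast hn

theorem position_shuttle {n : ℕ} (h : shuttle ω = n) : position n ω = 0 := by
  have h1 : ¬ ((n : ℕ∞) < shuttle ω) := by rw [h]; exact lt_irrefl _
  rw [lt_shuttle_iff] at h1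
  push Not at h1
  obtain ⟨m, k, hmk, hk, hm, h0⟩ := h1
  have h2 : ¬ ((k : ℕ∞) < shuttle ω) := by
    rw [lt_shuttle_iff]; push Not; exact ⟨m, k, hmk, le_rfl, hm, h0⟩
  have h3 : n ≤ k := by rw [h] at h2; exact_mod_cast not_lt.1 h2
  rwa [le_antisymm h3 hk]

theorem lt_shuttle_congr (h : ∀ i ≤ t, ω i = ω' i) :
    (t : ℕ∞) < shuttle ω ↔ (t : ℕ∞) < shuttle ω' := by
  rw [lt_shuttle_iff, lt_shuttle_iff]
  refine forall₄_congr fun m n hm hn => ?_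
  rw [position_congr h (hm.le.trans hn), position_congr h hn]

theorem lt_shuttle_of_runMax_lt (h : runMax t ω < N) : (t : ℕ∞) < shuttle ω :=
  lt_shuttle_iff.2 fun _ _ hm hn h1 =>
    absurd (position_le_runMax (hm.le.trans hn)) (by rw [h1]; omega)

theorem position_ne_zero_of_lt_shuttle (hN : 1 ≤ N) (h : (t : ℕ∞) < shuttle ω)
    (hM : runMax t ω = N) : position t ω ≠ 0 := by
  obtain ⟨m, hm, h1⟩ := exists_position_eq_runMax t ω
  rw [hM] at h1
  rcases hm.lt_or_eq with h2 | rfl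
  · exact lt_shuttle_iff.1 h m t h2 le_rfl h1
  · omega

theorem lt_shuttle_succ_iff : ((t + 1 : ℕ) : ℕ∞) < shuttle ω ↔
    (t : ℕ∞) < shuttle ω ∧ (runMax t ω = N → position (t + 1) ω ≠ 0) := by
  constructor
  · intro h
    refine ⟨lt_of_le_of_lt (by exact_mod_cast t.le_succ) h, fun hM => ?_⟩
    obtain ⟨m, hm, h1⟩ := exists_position_eq_runMax t ω
    exact lt_shuttle_iff.1 h m (t + 1) (by omega) le_rfl (h1.trans hM)
  · rintro ⟨h1, h2⟩
    rw [lt_shuttle_iff] at h1 ⊢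
    intro m n hmn hn hm
    rcases hn.lt_or_eq with h | rfl
    · exact h1 m n hmn (by omega) hm
    · refine h2 (le_antisymm (runMax_le _ _) ?_)
      exact hm.ge.trans (position_le_runMax (by omega))

theorem update_succ_eqOn (ω : Path N E) (t : ℕ) (z : Obs N E) :
    ∀ i ≤ t, Function.update ω (t + 1) z i = ω i := fun i hi =>
  Function.update_of_ne (by omega) _ _

theorem position_update (z : Obs N E) :
    position (t + 1) (Function.update ω (t + 1) z) = z.1 := by simp [position]

theorem runMax_update (z : Obs N E) :
    runMax t (Function.update ω (t + 1) z) = runMax t ω := runMax_congr (update_succ_eqOn ω t z)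

theorem runMax_succ_update (z : Obs N E) :
    runMax (t + 1) (Function.update ω (t + 1) z) = max (runMax t ω) z.1 := by
  rw [runMax_succ, runMax_update, position_update]

theorem lt_shuttle_succ_update_iff (z : Obs N E) :
    ((t + 1 : ℕ) : ℕ∞) < shuttle (Function.update ω (t + 1) z) ↔
      (t : ℕ∞) < shuttle ω ∧ (runMax t ω = N → (z.1 : ℕ) ≠ 0) := by
  rw [lt_shuttle_succ_iff, lt_shuttle_congr (update_succ_eqOn ω t z), runMax_update,
    position_update]

end PathLemmas

/-! ### Expected costs given a history, and their one-step equations -/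

section Cost

variable {N : ℕ} {E : Type*}

/-- The cost `f (X_t)` incurred at time `t`, which is `0` from the shuttle time on. -/
noncomputable def runCost (f : ℕ → ℝ) (t : ℕ) (ω : Path N E) : ℝ≥0∞ :=
  if (t : ℕ∞) < shuttle ω then ENNReal.ofReal (f (position t ω)) else 0

theorem shuttleCost_eq_tsum (f : ℕ → ℝ) (ω : Path N E) :
    shuttleCost f ω = ∑' t, runCost f t ω := rfl

theorem runCost_congr (f : ℕ → ℝ) {t u : ℕ} {ω ω' : Path N E} (h : ∀ i ≤ t, ω i = ω' i)
    (hu : u ≤ t) : runCost f u ω = runCost f u ω' := by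
  have h' : ∀ i ≤ u, ω i = ω' i := fun i hi => h i (hi.trans hu)
  simp only [runCost, lt_shuttle_congr h', position_congr h' le_rfl]

open Finset Preorder

theorem extend_frestrictLe_eqOn (t : ℕ) (ω : Path N E) :
    ∀ i ≤ t, RandomScale.extend (frestrictLe t ω) i = ω i := fun i hi => by
  simp [RandomScale.extend, min_eq_left hi]

variable [MeasurableSpace E]

/-- A measurable function of the first `t` coordinates is measurable for the history. -/
theorem measurable_history_of_congr {β : Type*} [MeasurableSpace β] {t : ℕ} {G : Path N E → β}
    (hG : Measurable G)
    (h : ∀ ω, G (RandomScale.extend (frestrictLe t ω)) = G ω) : Measurable[history N E t] G := by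
  have : G = (fun x => G (RandomScale.extend x)) ∘ frestrictLe t := funext fun ω => (h ω).symm
  rw [this, Filtration.piLE_eq_comap_frestrictLe]
  exact (hG.comp RandomScale.measurable_extend).comp (comap_measurable _)

/-- A real function that is measurable for the history depends on the first coordinates only. -/
theorem eq_of_measurable_history {t : ℕ} {G : Path N E → ℝ} (hG : Measurable[history N E t] G)
    {ω ω' : Path N E} (h : ∀ i ≤ t, ω i = ω' i) : G ω = G ω' := by
  obtain ⟨A, -, hA⟩ := measurable_piLE_iff_exists.1 (hG (measurableSet_singleton (G ω')))
  have h1 : frestrictLe t ω = frestrictLe t ω' := by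
    ext i : 1
    exact h i (mem_Iic.1 i.2)
  have h2 : ω' ∈ frestrictLe (π := fun _ => Obs N E) t ⁻¹' A := by rw [hA]; rfl
  rw [Set.mem_preimage, ← h1, ← Set.mem_preimage, hA] at h2
  exact h2

theorem measurableSet_lt_shuttle (t : ℕ) :
    MeasurableSet {ω : Path N E | (t : ℕ∞) < shuttle ω} := by
  simp only [lt_shuttle_iff, Set.ofPred_forall]
  refine .iInter fun m => .iInter fun n => .iInter fun _ => .iInter fun _ => ?_
  have h1 := RandomScale.measurable_position (N := N) (E := E) m (measurableSet_singleton N)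
  have h2 := RandomScale.measurable_position (N := N) (E := E) n (measurableSet_singleton 0)
  convert! h1.compl.union h2.compl using 1
  ext ω
  simp [imp_iff_not_or]

theorem measurable_runCost (f : ℕ → ℝ) (t : ℕ) :
    Measurable (runCost f t : Path N E → ℝ≥0∞) := by
  classical
  exact Measurable.ite (measurableSet_lt_shuttle t)
    ((measurable_of_countable f).comp (RandomScale.measurable_position t)).ennreal_ofReal
    measurable_const

theorem measurable_runMax (t : ℕ) : Measurable (runMax t : Path N E → ℕ) := by
  have h := Finset.measurable_range_sup'' (n := t)
    fun u _ => RandomScale.measurable_position (N := N) (E := E) u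
  convert! h using 2
  exact (Finset.sup'_eq_sup _ _).symm

namespace RandomScale

variable (s s₀ : RandomScale N E)

/-- An increment depends only on the observations up to any time at which its level has been
reached. -/
theorem W_congr {t k : ℕ} {ω ω' : Path N E} (h : ∀ i ≤ t, ω i = ω' i) (hk : k ≤ runMax t ω) :
    s.W k ω = s.W k ω' := by
  have h1 := eq_of_measurable_history (s.adapted k t) h
  have hk' : k ≤ runMax t ω' := runMax_congr h ▸ hk
  rwa [Set.indicator_of_mem (by exact hk), Set.indicator_of_mem (by exact hk')] at h1

theorem upProb_eq (t : ℕ) (ω : Path N E) :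
    s.upProb t (extend (frestrictLe t ω)) = stepProb N (fun k => s.W k ω) (position t ω) := by
  have hext := extend_frestrictLe_eqOn t ω
  have h1 : position t ω ≤ runMax t (extend (frestrictLe t ω)) :=
    (position_le_runMax le_rfl).trans (runMax_congr hext).ge
  rw [upProb, stepProb, position_congr hext le_rfl, s.W_congr hext h1,
    s.W_congr hext ((Nat.sub_le _ 1).trans h1)]

theorem stepProb_mem (x : ℕ) (ω : Path N E) :
    0 ≤ stepProb N (fun k => s.W k ω) x ∧ stepProb N (fun k => s.W k ω) x ≤ 1 := by
  unfold stepProb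
  split_ifs
  · simp
  · simp
  · have h : 0 < s.W x ω / s.W (x - 1) ω := div_pos (s.W_pos _ _) (s.W_pos _ _)
    exact ⟨by positivity, by rw [div_le_one (by positivity)]; linarith⟩

variable (ν : Measure E) [IsProbabilityMeasure ν]

theorem lintegral_kernel (t : ℕ) (ω : Path N E) {G : Obs N E → ℝ≥0∞} (hG : Measurable G) :
    ∫⁻ z, G z ∂s.kernel ν t (frestrictLe t ω) =
      ENNReal.ofReal (stepProb N (fun k => s.W k ω) (position t ω))
          * ∫⁻ e, G (stepUp (ω t).1, e) ∂ν
        + ENNReal.ofReal (1 - stepProb N (fun k => s.W k ω) (position t ω))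
          * ∫⁻ e, G (stepDown (ω t).1, e) ∂ν := by
  change ∫⁻ z, G z ∂((_ • _ + _ • _ : Measure (Fin (N + 1))).prod ν) = _
  rw [lintegral_prod _ hG.aemeasurable, lintegral_add_measure, lintegral_smul_measure,
    lintegral_smul_measure, lintegral_dirac, lintegral_dirac, upProb_eq,
    extend_frestrictLe_eqOn t ω t le_rfl]
  rfl

/-- The expected value of `G` given the observations `ω 0, …, ω t`. -/
noncomputable def expect (t : ℕ) (ω : Path N E) (G : Path N E → ℝ≥0∞) : ℝ≥0∞ :=
  ∫⁻ x, G x ∂Kernel.traj (X := fun _ => Obs N E) (s.kernel ν) t (frestrictLe t ω)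

theorem expect_runCost_add (f : ℕ → ℝ) (t : ℕ) (ω : Path N E) {G : Path N E → ℝ≥0∞}
    (hG : Measurable G) :
    s.expect ν t ω (fun x => runCost f t x + G x) = runCost f t ω
      + ENNReal.ofReal (stepProb N (fun k => s.W k ω) (position t ω))
          * ∫⁻ e, s.expect ν (t + 1) (Function.update ω (t + 1) (stepUp (ω t).1, e)) G ∂ν
      + ENNReal.ofReal (1 - stepProb N (fun k => s.W k ω) (position t ω))
          * ∫⁻ e, s.expect ν (t + 1) (Function.update ω (t + 1) (stepDown (ω t).1, e)) G ∂ν := by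
  have h1 := lintegral_traj_add_of_dependsOn (X := fun _ => Obs N E) (s.kernel ν) t ω
    (measurable_runCost f t) (H := G) fun x y h => runCost_congr f h le_rfl
  have h2 := lintegral_traj_eq_lintegral_succ (X := fun _ => Obs N E) (s.kernel ν) t ω hG
  have h3 : Measurable fun z : Obs N E => ∫⁻ x, G x ∂Kernel.traj (X := fun _ => Obs N E)
      (s.kernel ν) (t + 1) (frestrictLe (t + 1) (Function.update ω (t + 1) z)) :=
    hG.lintegral_kernel.comp ((measurable_frestrictLe _).comp (measurable_update ω))
  rw [s.lintegral_kernel ν t ω h3] at h2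
  rw [expect, h1, h2, add_assoc]
  rfl

/-- The expected cost from time `t` on, given the observations `ω 0, …, ω t`. -/
noncomputable def value (f : ℕ → ℝ) (t : ℕ) (ω : Path N E) : ℝ≥0∞ :=
  s.expect ν t ω fun x => ∑' i, runCost f (t + i) x

/-- A truncation of `value`: the expected cost in the time interval `[t, t + n)`, given the
observations `ω 0, …, ω t`. -/
noncomputable def valueUpTo (f : ℕ → ℝ) (n t : ℕ) (ω : Path N E) : ℝ≥0∞ :=
  s.expect ν t ω fun x => ∑ i ∈ range n, runCost f (t + i) x

theorem value_eq (f : ℕ → ℝ) (t : ℕ) (ω : Path N E) :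
    s.value ν f t ω = runCost f t ω
      + ENNReal.ofReal (stepProb N (fun k => s.W k ω) (position t ω))
          * ∫⁻ e, s.value ν f (t + 1) (Function.update ω (t + 1) (stepUp (ω t).1, e)) ∂ν
      + ENNReal.ofReal (1 - stepProb N (fun k => s.W k ω) (position t ω))
          * ∫⁻ e, s.value ν f (t + 1) (Function.update ω (t + 1) (stepDown (ω t).1, e)) ∂ν := by
  have h : ∀ x : Path N E, ∑' i, runCost f (t + i) x
      = runCost f t x + ∑' i, runCost f (t + 1 + i) x := fun x => by
    rw [tsum_eq_zero_add' ENNReal.summable]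
    simp only [add_zero, add_assoc, add_comm 1]
  rw [value, funext h]
  exact s.expect_runCost_add ν f t ω (Measurable.tsum fun i => measurable_runCost f _)

theorem valueUpTo_succ (f : ℕ → ℝ) (n t : ℕ) (ω : Path N E) :
    s.valueUpTo ν f (n + 1) t ω = runCost f t ω
      + ENNReal.ofReal (stepProb N (fun k => s.W k ω) (position t ω))
          * ∫⁻ e, s.valueUpTo ν f n (t + 1) (Function.update ω (t + 1) (stepUp (ω t).1, e)) ∂ν
      + ENNReal.ofReal (1 - stepProb N (fun k => s.W k ω) (position t ω))
          * ∫⁻ e, s.valueUpTo ν f n (t + 1)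
              (Function.update ω (t + 1) (stepDown (ω t).1, e)) ∂ν := by
  have h : ∀ x : Path N E, ∑ i ∈ range (n + 1), runCost f (t + i) x
      = runCost f t x + ∑ i ∈ range n, runCost f (t + 1 + i) x := fun x => by
    rw [sum_range_succ', add_comm]
    simp only [add_zero, add_assoc, add_comm 1]
  rw [valueUpTo, funext h]
  exact s.expect_runCost_add ν f t ω (Finset.measurable_fun_sum _ fun i _ => measurable_runCost f _)

theorem value_le_of_valueUpTo_le (f : ℕ → ℝ) (t : ℕ) (ω : Path N E) {c : ℝ≥0∞}
    (h : ∀ n, s.valueUpTo ν f n t ω ≤ c) : s.value ν f t ω ≤ c := by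
  simp only [value, expect, ENNReal.tsum_eq_iSup_nat]
  rw [lintegral_iSup (fun n => Finset.measurable_fun_sum _ fun i _ => measurable_runCost f _)]
  · exact iSup_le h
  · intro m n hmn x
    exact Finset.sum_le_sum_of_subset (range_mono hmn)

theorem le_value (f : ℕ → ℝ) (t : ℕ) (ω : Path N E) {a b : ℝ≥0∞}
    (ha : ∀ e, a ≤ s.value ν f (t + 1) (Function.update ω (t + 1) (stepUp (ω t).1, e)))
    (hb : ∀ e, b ≤ s.value ν f (t + 1) (Function.update ω (t + 1) (stepDown (ω t).1, e))) :
    runCost f t ω + ENNReal.ofReal (stepProb N (fun k => s.W k ω) (position t ω)) * a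
      + ENNReal.ofReal (1 - stepProb N (fun k => s.W k ω) (position t ω)) * b
      ≤ s.value ν f t ω := by
  rw [value_eq]
  gcongr
  · simpa using lintegral_mono (μ := ν) ha
  · simpa using lintegral_mono (μ := ν) hb

theorem valueUpTo_le (f : ℕ → ℝ) (n t : ℕ) (ω : Path N E) {a b : ℝ≥0∞}
    (ha : ∀ e, s.valueUpTo ν f n (t + 1) (Function.update ω (t + 1) (stepUp (ω t).1, e)) ≤ a)
    (hb : ∀ e, s.valueUpTo ν f n (t + 1) (Function.update ω (t + 1) (stepDown (ω t).1, e)) ≤ b) :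
    s.valueUpTo ν f (n + 1) t ω ≤
    runCost f t ω + ENNReal.ofReal (stepProb N (fun k => s.W k ω) (position t ω)) * a
      + ENNReal.ofReal (1 - stepProb N (fun k => s.W k ω) (position t ω)) * b := by
  rw [valueUpTo_succ]
  gcongr
  · simpa using lintegral_mono (μ := ν) ha
  · simpa using lintegral_mono (μ := ν) hb

theorem expect_shuttleCost (f : ℕ → ℝ) (t : ℕ) (ω : Path N E) :
    s.expect ν t ω (shuttleCost f) = ∑ u ∈ range t, runCost f u ω + s.value ν f t ω := by
  have h : ∀ x : Path N E, shuttleCost f x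
      = ∑ u ∈ range t, runCost f u x + ∑' i, runCost f (t + i) x := fun x => by
    rw [shuttleCost_eq_tsum, ← ENNReal.summable.sum_add_tsum_nat_add' (k := t)]
    simp only [add_comm t]
  rw [funext h]
  exact lintegral_traj_add_of_dependsOn (X := fun _ => Obs N E) (s.kernel ν) t ω
    (Finset.measurable_fun_sum _ fun i _ => measurable_runCost f _) fun x y h =>
      Finset.sum_congr rfl fun u hu => runCost_congr f h (mem_range.1 hu).le

theorem kernel_absolutelyContinuous (t : ℕ) (h : (i : Iic t) → Obs N E) :
    s₀.kernel ν t h ≪ s.kernel ν t h := by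
  change (_ • _ + _ • _ : Measure (Fin (N + 1))).prod ν
    ≪ (_ • _ + _ • _ : Measure (Fin (N + 1))).prod ν
  refine Measure.AbsolutelyContinuous.prod ?_ .rfl
  refine Measure.AbsolutelyContinuous.mk fun A _ hA => ?_
  simp only [Measure.add_apply, Measure.smul_apply, smul_eq_mul, add_eq_zero, mul_eq_zero,
    ENNReal.ofReal_eq_zero] at hA ⊢
  have hpos : ∀ r : RandomScale N E, 0 < r.W (position t (extend h)) (extend h)
      / r.W (position t (extend h) - 1) (extend h) := fun r =>
    div_pos (r.W_pos _ _) (r.W_pos _ _)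
  refine ⟨hA.1.imp_left fun h1 => ?_, hA.2.imp_left fun h1 => ?_⟩
  · revert h1
    unfold upProb
    split_ifs
    · exact id
    · exact id
    · intro h1
      have := hpos s
      exact absurd h1 (not_le.2 (by positivity))
  · revert h1
    unfold upProb
    split_ifs
    · exact id
    · exact id
    · intro h1
      have := hpos s
      rw [sub_nonpos, le_div_iff₀ (by positivity)] at h1
      linarith

theorem measurable_shuttleCost (f : ℕ → ℝ) : Measurable (shuttleCost f : Path N E → ℝ≥0∞) :=
  Measurable.tsum fun t => measurable_runCost f t

/-- The conditional expected cost under any control, as a function of the path. As the laws of the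
controls are equivalent on the history up to time `t`, the formula holds almost surely for each of
them. -/
theorem condCost_ae_eq (f : ℕ → ℝ) (t : ℕ) :
    s.condCost ν f t =ᵐ[s₀.law ν]
      fun ω => ∑ u ∈ range t, runCost f u ω + s.value ν f t ω := by
  have hm : Measurable[history N E t] fun ω => s.expect ν t ω (shuttleCost f) := by
    rw [Filtration.piLE_eq_comap_frestrictLe]
    exact (measurable_shuttleCost f).lintegral_kernel.comp (comap_measurable _)
  have h1 : s.condCost ν f t =ᵐ[s.law ν] fun ω => s.expect ν t ω (shuttleCost f) :=
    condLExp_trajMeasure (X := fun _ => Obs N E) (s.kernel ν) _ t (measurable_shuttleCost f)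
  suffices h : s.condCost ν f t =ᵐ[s₀.law ν] fun ω => s.expect ν t ω (shuttleCost f) from
    h.trans (.of_forall fun ω => s.expect_shuttleCost ν f t ω)
  have hset : MeasurableSet[history N E t]
      {ω | s.condCost ν f t ω = s.expect ν t ω (shuttleCost f)} :=
    measurableSet_eq_fun (measurable_condLExp _ _ _) hm
  obtain ⟨A, hA, hA'⟩ := measurable_piLE_iff_exists.1 hset.compl
  have hac := trajMeasure_map_frestrictLe_absolutelyContinuous (X := fun _ => Obs N E)
    (s₀.kernel ν) ((Measure.dirac 0).prod ν) (s.kernel ν)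
    (fun n h => s.kernel_absolutelyContinuous s₀ ν n h) t
  have h2 : (s.law ν) (frestrictLe (π := fun _ => Obs N E) t ⁻¹' A) = 0 := by rw [hA']; exact h1
  rw [law, ← Measure.map_apply (measurable_frestrictLe t) hA] at h2
  have h3 := hac h2
  rw [Measure.map_apply (measurable_frestrictLe t) hA, hA'] at h3
  exact h3

end RandomScale

end Cost

/-! ### Lower bound for every control -/

namespace RandomScale

variable {N : ℕ} {E : Type*} [MeasurableSpace E] (s s₀ : RandomScale N E)

/-- The cost to come according to the explicit formula; it is `0` from the shuttle time on. -/
noncomputable def remaining (f : ℕ → ℝ) (t : ℕ) (ω : Path N E) : ℝ :=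
  if (t : ℕ∞) < shuttle ω then
    remCost N f (fun k => s.W k ω) (runMax t ω) (position t ω)
  else 0

variable {f : ℕ → ℝ}

theorem remaining_nonneg (hf : ∀ n ≤ N, 0 < f n) (t : ℕ) (ω : Path N E) :
    0 ≤ s.remaining f t ω := by
  unfold remaining
  split_ifs
  · exact remCost_nonneg hf (fun k => s.W_pos k ω) (runMax_le _ _) (position_le_runMax le_rfl)
  · exact le_rfl

/-- The explicit formula one step later, in terms of the increments known before the step. -/
theorem remaining_update {t : ℕ} {ω : Path N E} (ht : (t : ℕ∞) < shuttle ω) (z : Obs N E)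
    (hz : (z.1 : ℕ) ≤ runMax t ω + 1) :
    s.remaining f (t + 1) (Function.update ω (t + 1) z)
      = remCost N f (fun k => s.W k ω) (max (runMax t ω) z.1) z.1 := by
  unfold remaining
  simp only [lt_shuttle_succ_update_iff, runMax_succ_update, position_update]
  split_ifs with h
  · refine remCost_congr (max_le (runMax_le _ _) (Nat.le_of_lt_succ z.1.2)) (le_max_right _ _)
      fun k hk => ?_
    exact s.W_congr (update_succ_eqOn ω t z) (by rw [runMax_update]; omega)
  · -- the step has completed the shuttle
    simp only [ht, true_and, Classical.not_imp, not_not] at h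
    simp [h.1, h.2, remCost]

/-- The candidate is the cost incurred so far plus the explicit formula for the cost to come. -/
theorem candidate_eq (f : ℕ → ℝ) (t : ℕ) (ω : Path N E) :
    s.candidate f t ω =
      ∑ u ∈ Finset.range t, (if (u : ℕ∞) < shuttle ω then f (position u ω) else 0)
        + s.remaining f t ω := by
  unfold candidate remaining
  by_cases ht : (t : ℕ∞) < shuttle ω
  · have hsum : ∑ u ∈ Finset.range t, (if (u : ℕ∞) < shuttle ω then f (position u ω) else 0)
        = ∑ u ∈ Finset.range t, f (position u ω) :=
      Finset.sum_congr rfl fun u hu => if_pos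
        (lt_trans (by exact_mod_cast Finset.mem_range.1 hu) ht)
    rw [hsum, min_eq_left ht.le, ENat.toNat_natCast, if_pos ht, remCost]
    split_ifs
    · rw [add_sub_assoc]; rfl
    · rfl
  · have hM : ¬ runMax t ω < N := fun h => ht (lt_shuttle_of_runMax_lt h)
    have hle := not_lt.1 ht
    obtain ⟨n, hn⟩ := ENat.ne_top_iff_exists.1 (ne_top_of_le_ne_top (ENat.natCast_ne_top t) hle)
    have hnt : n ≤ t := by rw [← hn] at hle; exact_mod_cast hle
    simp only [if_neg hM, min_eq_right hle, if_neg ht]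
    simp only [← hn, ENat.toNat_natCast, position_shuttle hn.symm, phi_zero_zero, Nat.cast_lt]
    rw [← Finset.sum_filter]
    congr 2
    ext u
    simp only [Finset.mem_range, Finset.mem_filter]
    omega

theorem ofReal_candidate (hf : ∀ n ≤ N, 0 < f n) (t : ℕ) (ω : Path N E) :
    ENNReal.ofReal (s.candidate f t ω) =
      ∑ u ∈ Finset.range t, runCost f u ω + ENNReal.ofReal (s.remaining f t ω) := by
  have hnn : ∀ u : ℕ, 0 ≤ if (u : ℕ∞) < shuttle ω then f (position u ω) else 0 := fun u => by
    split_ifs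
    · exact (hf _ (position_le u ω)).le
    · exact le_rfl
  rw [s.candidate_eq, ENNReal.ofReal_add (Finset.sum_nonneg fun u _ => hnn u)
    (s.remaining_nonneg hf t ω), ENNReal.ofReal_sum_of_nonneg fun u _ => hnn u]
  congr 1
  refine Finset.sum_congr rfl fun u _ => ?_
  rw [runCost]
  split_ifs <;> simp

theorem remaining_congr {y t : ℕ} {ω : Path N E} (hs : s ∈ s₀.constrained y)
    (hM : runMax t ω = y) : s.remaining f t ω = s₀.remaining f t ω := by
  unfold remaining
  rw [remCost_congr (runMax_le _ _) (position_le_runMax le_rfl) fun k hk => ?_]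
  rw [hs k (hM ▸ hk)]

variable (ν : Measure E) [IsProbabilityMeasure ν]

theorem stepUp_val (x : Fin (N + 1)) : (stepUp x : ℕ) = min ((x : ℕ) + 1) N := rfl

theorem stepDown_val (x : Fin (N + 1)) : (stepDown x : ℕ) = x - 1 := rfl

/-- The least value `value` takes over all times `t` and paths at `x` whose running maximum is `m`,
whose shuttle is not complete, and whose increments up to the level `m` are `w`. -/
noncomputable def infValue (f w : ℕ → ℝ) (m x : ℕ) : ℝ≥0∞ :=
  ⨅ (t : ℕ) (ω : Path N E) (_ : runMax t ω = m ∧ (t : ℕ∞) < shuttle ω ∧ position t ω = x ∧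
    ∀ k ≤ m, s.W k ω = w k), s.value ν f t ω

theorem infValue_le {w : ℕ → ℝ} {m x t : ℕ} {ω : Path N E} (hM : runMax t ω = m)
    (ht : (t : ℕ∞) < shuttle ω) (hx : position t ω = x) (hw : ∀ k ≤ m, s.W k ω = w k) :
    s.infValue ν f w m x ≤ s.value ν f t ω :=
  iInf₂_le_of_le t ω (iInf_le _ ⟨hM, ht, hx, hw⟩)

/-- A step that does not raise the running maximum and does not complete the shuttle. -/
theorem infValue_le_update {w : ℕ → ℝ} {m t : ℕ} {ω : Path N E} (hM : runMax t ω = m)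
    (ht : (t : ℕ∞) < shuttle ω) (hw : ∀ k ≤ m, s.W k ω = w k) (z : Obs N E)
    (hzm : (z.1 : ℕ) ≤ m) (hz0 : m = N → (z.1 : ℕ) ≠ 0) :
    s.infValue ν f w m z.1 ≤ s.value ν f (t + 1) (Function.update ω (t + 1) z) := by
  refine s.infValue_le ν ?_ ((lt_shuttle_succ_update_iff z).2 ⟨ht, fun h => hz0 (hM ▸ h)⟩)
    (position_update z) fun k hk => ?_
  · rw [runMax_succ_update, hM, max_eq_left hzm]
  · rw [← hw k hk]
    exact s.W_congr (update_succ_eqOn ω t z) (by rw [runMax_update]; omega)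

/-- To bound `infValue` from below, it suffices to bound the values one step later. -/
theorem le_infValue {w : ℕ → ℝ} {m x : ℕ} (hxm : x ≤ m) {a b : ℝ≥0∞}
    (ha : ∀ t (ω : Path N E), runMax t ω = m → (t : ℕ∞) < shuttle ω → position t ω = x →
      (∀ k ≤ m, s.W k ω = w k) →
      ∀ e, a ≤ s.value ν f (t + 1) (Function.update ω (t + 1) (stepUp (ω t).1, e)))
    (hb : ∀ t (ω : Path N E), runMax t ω = m → (t : ℕ∞) < shuttle ω → position t ω = x →
      (∀ k ≤ m, s.W k ω = w k) →
      ∀ e, b ≤ s.value ν f (t + 1) (Function.update ω (t + 1) (stepDown (ω t).1, e))) :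
    ENNReal.ofReal (f x) + ENNReal.ofReal (stepProb N w x) * a
      + ENNReal.ofReal (1 - stepProb N w x) * b ≤ s.infValue ν f w m x := by
  refine le_iInf fun t => le_iInf fun ω => le_iInf fun ⟨hM, ht, hx, hw⟩ => ?_
  have h := s.le_value ν f t ω (ha t ω hM ht hx hw) (hb t ω hM ht hx hw)
  rw [hx, stepProb_congr (w' := w) fun k hk => hw k (hk.trans hxm), runCost, if_pos ht, hx] at h
  exact h

/-- No control beats the explicit formula on the way back from `N` to `0`. -/
theorem ofReal_remaining_le_value_of_runMax_eq (hN : 1 ≤ N) (hf : ∀ n ≤ N, 0 < f n) {t : ℕ}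
    {ω : Path N E} (hM : runMax t ω = N) :
    ENNReal.ofReal (s.remaining f t ω) ≤ s.value ν f t ω := by
  unfold remaining
  split_ifs with ht
  swap; · simp
  set w := fun k => s.W k ω with hw
  -- The value is `0` once the chain is back at `0`.
  set a : ℕ → ℝ≥0∞ := fun x => if x = 0 then 0 else s.infValue ν f w N x with ha
  have hstep : ∀ t' (ω' : Path N E), runMax t' ω' = N → (t' : ℕ∞) < shuttle ω' →
      (∀ k ≤ N, s.W k ω' = w k) → ∀ z : Obs N E,
      a z.1 ≤ s.value ν f (t' + 1) (Function.update ω' (t' + 1) z) := by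
    intro t' ω' hM' ht' hw' z
    simp only [ha]
    split_ifs with h0
    · exact zero_le
    · exact s.infValue_le_update ν hM' ht' hw' z (Nat.le_of_lt_succ z.1.2) fun _ => h0
  have hsuper : ∀ x ≤ N, x ≠ 0 → ENNReal.ofReal (f x)
      + ENNReal.ofReal (stepProb N w x) * a (min (x + 1) N)
      + ENNReal.ofReal (1 - stepProb N w x) * a (x - 1) ≤ a x := by
    intro x hxN hx0
    rw [show a x = s.infValue ν f w N x from if_neg hx0]
    refine s.le_infValue ν hxN (fun t' ω' hM' ht' hx' hw' e => ?_)
      (fun t' ω' hM' ht' hx' hw' e => ?_)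
    · rw [← hx']; exact hstep t' ω' hM' ht' hw' (stepUp (ω' t').1, e)
    · rw [← hx']; exact hstep t' ω' hM' ht' hw' (stepDown (ω' t').1, e)
  have h1 := ofReal_phi_le_of_superharmonic hN hf (fun k => s.W_pos k ω) hsuper (position_le t ω)
  rw [hM, remCost, if_neg (lt_irrefl N)]
  refine h1.trans ?_
  simp only [ha, position_ne_zero_of_lt_shuttle hN ht hM, if_false]
  exact s.infValue_le ν hM ht rfl fun _ _ => rfl

/-- No control beats the explicit formula. The proof goes down through the values of the running
maximum: while it stays at `m`, the increments up to the level `m` are fixed, and the minimum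
principle transports the bound from the first visit of `m + 1`. -/
theorem ofReal_remaining_le_value (hN : 1 ≤ N) (hf : ∀ n ≤ N, 0 < f n) (t : ℕ) (ω : Path N E) :
    ENNReal.ofReal (s.remaining f t ω) ≤ s.value ν f t ω := by
  suffices H : ∀ m ≤ N, ∀ t (ω : Path N E), runMax t ω = m →
      ENNReal.ofReal (s.remaining f t ω) ≤ s.value ν f t ω from
    H _ (runMax_le t ω) t ω rfl
  intro m hm
  induction hm using Nat.decreasingInduction with
  | self => exact fun t ω => s.ofReal_remaining_le_value_of_runMax_eq ν hN hf
  | of_succ m hmN ih =>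
    intro t ω hM
    have ht : (t : ℕ∞) < shuttle ω := lt_shuttle_of_runMax_lt (hM ▸ hmN)
    set w := fun k => s.W k ω with hw
    have hwpos : ∀ k, 0 < w k := fun k => s.W_pos k ω
    set K := optTotal N f w (m + 1) with hK
    -- At `m + 1` the infimum is replaced by the bound known from the induction hypothesis.
    set a : ℕ → ℝ≥0∞ := fun x => if x = m + 1 then ENNReal.ofReal (K - phi N f w (m + 1) 0)
      else s.infValue ν f w m x with ha
    have hsuper : ∀ x ≤ m, ENNReal.ofReal (f x) + ENNReal.ofReal (stepProb N w x) * a (x + 1)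
        + ENNReal.ofReal (1 - stepProb N w x) * a (x - 1) ≤ a x := by
      intro x hxm
      rw [show a x = s.infValue ν f w m x from if_neg (by omega)]
      refine s.le_infValue ν hxm (fun t' ω' hM' ht' hx' hw' e => ?_)
        (fun t' ω' hM' ht' hx' hw' e => ?_)
      · have hup : ((stepUp (ω' t').1 : Fin (N + 1)) : ℕ) = x + 1 := by
          rw [stepUp_val, ← hx']
          refine min_eq_left ?_
          change position t' ω' + 1 ≤ N
          omega
        simp only [ha]
        split_ifs with hx
        · -- a step from `m` to `m + 1`: the increments below `m + 1` are already those of `w`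
          have hx : x = m := by omega
          refine le_trans (le_of_eq ?_) (ih (t' + 1) _ ?_)
          · rw [s.remaining_update ht' _ (by simp only; omega)]
            simp only [hM', hup, hx, max_eq_right m.le_succ]
            rw [remCost_congr (w' := w) (by omega) le_rfl fun k hk => hw' k (by omega),
              remCost_self hf hwpos hmN]
          · rw [runMax_succ_update, hM']
            simp only [hup]
            omega
        · rw [← hup]
          exact s.infValue_le_update ν hM' ht' hw' (stepUp (ω' t').1, e) (by simp only; omega)
            (by omega)
      · have hdown : ((stepDown (ω' t').1 : Fin (N + 1)) : ℕ) = x - 1 := by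
          rw [stepDown_val, ← hx']; rfl
        rw [show a (x - 1) = s.infValue ν f w m (x - 1) from if_neg (by omega), ← hdown]
        exact s.infValue_le_update ν hM' ht' hw' (stepDown (ω' t').1, e) (by simp only; omega)
          (by omega)
    have hx : position t ω ≤ m := hM ▸ position_le_runMax le_rfl
    have h1 := ofReal_sub_phi_le_of_superharmonic hf hwpos hmN (K := K)
      (by simp [ha]) hsuper (x := position t ω) (by omega)
    rw [remaining, if_pos ht, hM, remCost, if_pos hmN]
    calc _ ≤ ENNReal.ofReal (K - phi N f w (position t ω) 0) :=
          ENNReal.ofReal_le_ofReal (sub_le_sub_right (optTotal_le_succ hf hwpos hmN) _)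
      _ ≤ a (position t ω) := h1
      _ = s.infValue ν f w m (position t ω) := if_neg (by omega)
      _ ≤ _ := s.infValue_le ν hM ht rfl fun _ _ => rfl

/-! ### The optimal control -/

/-- If the optimal cost stays constant from the level `y` on, the explicit formula is an upper bound
for the expected cost over any bounded time interval. -/
theorem valueUpTo_le_ofReal_remaining (hN : 1 ≤ N) (hf : ∀ n ≤ N, 0 < f n) {y : ℕ}
    (hopt : ∀ m ω, y ≤ m → m < N →
      optTotal N f (fun k => s.W k ω) (m + 1) = optTotal N f (fun k => s.W k ω) m)
    (n t : ℕ) (ω : Path N E) (hy : y ≤ runMax t ω) :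
    s.valueUpTo ν f n t ω ≤ ENNReal.ofReal (s.remaining f t ω) := by
  induction n generalizing t ω with
  | zero => simp [valueUpTo, expect]
  | succ n ih =>
    have hbound : ∀ z : Obs N E,
        s.valueUpTo ν f n (t + 1) (Function.update ω (t + 1) z)
          ≤ ENNReal.ofReal (s.remaining f (t + 1) (Function.update ω (t + 1) z)) := fun z =>
      ih _ _ (by rw [runMax_succ_update]; exact hy.trans (le_max_left _ _))
    have hpos : ((ω t).1 : ℕ) ≤ runMax t ω := position_le_runMax (ω := ω) le_rfl
    by_cases ht : (t : ℕ∞) < shuttle ω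
    · have hup : ∀ e, s.valueUpTo ν f n (t + 1) (Function.update ω (t + 1) (stepUp (ω t).1, e))
          ≤ ENNReal.ofReal (remCost N f (fun k => s.W k ω)
            (max (runMax t ω) (min (position t ω + 1) N)) (min (position t ω + 1) N)) := fun e =>
        (hbound _).trans_eq (congrArg _ (s.remaining_update ht (stepUp (ω t).1, e)
          (by rw [stepUp_val]; omega)))
      have hdown : ∀ e, s.valueUpTo ν f n (t + 1)
          (Function.update ω (t + 1) (stepDown (ω t).1, e))
          ≤ ENNReal.ofReal (remCost N f (fun k => s.W k ω)
            (max (runMax t ω) (position t ω - 1)) (position t ω - 1)) := fun e =>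
        (hbound _).trans_eq (congrArg _ (s.remaining_update ht (stepDown (ω t).1, e)
          (by rw [stepDown_val]; omega)))
      refine (s.valueUpTo_le ν f n t ω hup hdown).trans (le_of_eq ?_)
      have hp := s.stepProb_mem (position t ω) ω
      have hW : ∀ k, 0 < s.W k ω := fun k => s.W_pos k ω
      have hM := runMax_le t ω
      have hstep := remCost_step hf hW hM (position_le_runMax le_rfl)
        (position_ne_zero_of_lt_shuttle hN ht) (hopt _ ω hy)
      have e3 : max (runMax t ω) (position t ω - 1) = runMax t ω :=
        max_eq_left ((Nat.sub_le _ _).trans (position_le_runMax le_rfl))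
      have h1 := remCost_nonneg hf hW (max_le hM (min_le_right (position t ω + 1) N))
        (le_max_right (runMax t ω) _)
      have h2 := remCost_nonneg hf hW hM
        ((Nat.sub_le (position t ω) 1).trans (position_le_runMax le_rfl))
      rw [remaining, if_pos ht, hstep, runCost, if_pos ht, e3,
        ← ENNReal.ofReal_mul hp.1, ← ENNReal.ofReal_mul (by linarith [hp.2]),
        ← ENNReal.ofReal_add (hf _ (position_le _ _)).le (mul_nonneg hp.1 h1),
        ← ENNReal.ofReal_add _ (mul_nonneg (by linarith [hp.2]) h2)]
      exact add_nonneg (hf _ (position_le _ _)).le (mul_nonneg hp.1 h1)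
    · have hzero : ∀ z : Obs N E,
          s.valueUpTo ν f n (t + 1) (Function.update ω (t + 1) z) ≤ 0 := fun z => by
        have h := hbound z
        rwa [remaining, if_neg (by rw [lt_shuttle_succ_update_iff]; tauto),
          ENNReal.ofReal_zero] at h
      refine (s.valueUpTo_le ν f n t ω (fun e => hzero _) (fun e => hzero _)).trans ?_
      simp [runCost, ht]

variable (f)

/-- The optimal control: `s₀` below the level `y`, and increments proportional to `√(2 f̃)` from the
level `y` on. The values at the levels `k ≥ N` play no role. -/
noncomputable def optimalFrom (hf : ∀ n ≤ N, 0 < f n) (y : ℕ) (hy : 1 ≤ y) (hyN : y ≤ N) :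
    RandomScale N E where
  W k ω := if k < y then s₀.W k ω
    else if k < N then √(s₀.scale y ω / s₀.speed f y ω) * √(2 * avg f k) else 1
  measurable_W k := by
    have h := s₀.measurable_W
    split_ifs
    · exact h k
    · unfold scale speed
      fun_prop
    · exact measurable_const
  W_pos k ω := by
    split_ifs with h1 h2
    · exact s₀.W_pos k ω
    · have hne : (Finset.range y).Nonempty := ⟨0, Finset.mem_range.2 hy⟩
      have h3 : 0 < s₀.scale y ω := Finset.sum_pos (fun k _ => s₀.W_pos k ω) hne
      have h4 : 0 < s₀.speed f y ω := Finset.sum_pos (fun k hk => by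
        have := avg_pos hf ((Finset.mem_range.1 hk).trans_le hyN)
        have := s₀.W_pos k ω
        positivity) hne
      have := avg_pos hf h2
      positivity
    · exact one_pos
  W_zero ω := by rw [if_pos (by omega), s₀.W_zero]
  adapted k t := by
    have hmeas := s₀.measurable_W
    refine measurable_history_of_congr (Measurable.indicator ?_ ?_) fun ω => ?_
    · split_ifs
      · exact hmeas k
      · unfold scale speed
        fun_prop
      · exact measurable_const
    · exact measurableSet_le measurable_const (measurable_runMax t)
    · have hext := extend_frestrictLe_eqOn t ω
      have hM := runMax_congr hext
      by_cases hk : k ≤ runMax t ω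
      · have hW : ∀ j ≤ k, s₀.W j (extend (Preorder.frestrictLe t ω)) = s₀.W j ω := fun j hj =>
          s₀.W_congr hext ((hj.trans hk).trans hM.ge)
        rw [Set.indicator_of_mem (by simpa [hM] using hk),
          Set.indicator_of_mem (by simpa using hk)]
        split_ifs with h1 h2
        · exact hW k le_rfl
        · have e1 : s₀.scale y (extend (Preorder.frestrictLe t ω)) = s₀.scale y ω :=
            Finset.sum_congr rfl fun j hj => hW j (by have := Finset.mem_range.1 hj; omega)
          have e2 : s₀.speed f y (extend (Preorder.frestrictLe t ω)) = s₀.speed f y ω :=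
            Finset.sum_congr rfl fun j hj => by
              rw [hW j (by have := Finset.mem_range.1 hj; omega)]
          rw [e1, e2]
        · rfl
      · rw [Set.indicator_of_notMem (by simpa [hM] using hk),
          Set.indicator_of_notMem (by simpa using hk)]

theorem optTotal_optimalFrom (hf : ∀ n ≤ N, 0 < f n) {y m : ℕ} (hy : 1 ≤ y) (hyN : y ≤ N)
    (hym : y ≤ m) (hm : m ≤ N) (ω : Path N E) :
    optTotal N f (fun k => (s₀.optimalFrom f hf y hy hyN).W k ω) m
      = optTotal N f (fun k => (s₀.optimalFrom f hf y hy hyN).W k ω) y := by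
  refine optTotal_eq_of_optimal hf (fun k => W_pos _ k ω) hy hym hm fun x hx hxN => ?_
  have hlow : ∀ k ∈ Finset.range y, (s₀.optimalFrom f hf y hy hyN).W k ω = s₀.W k ω :=
    fun k hk => if_pos (Finset.mem_range.1 hk)
  have h1 : ∑ k ∈ Finset.range y, (s₀.optimalFrom f hf y hy hyN).W k ω = s₀.scale y ω :=
    Finset.sum_congr rfl hlow
  have h2 : ∑ k ∈ Finset.range y, 2 * avg f k / (s₀.optimalFrom f hf y hy hyN).W k ω
      = s₀.speed f y ω := Finset.sum_congr rfl fun k hk => by rw [hlow k hk]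
  rw [h1, h2]
  simp only [optimalFrom, if_neg (not_lt.2 hx), if_pos hxN]

/-- With `y' = max y 1`, constancy also holds from `y = 0` on, as the increment at `0` is fixed. -/
theorem optTotal_optimalFrom_succ (hf : ∀ n ≤ N, 0 < f n) (hN : 1 ≤ N) {y m : ℕ}
    (hyN : max y 1 ≤ N) (hym : y ≤ m) (hm : m < N) (ω : Path N E) :
    optTotal N f (fun k => (s₀.optimalFrom f hf (max y 1) (le_max_right _ _) hyN).W k ω) (m + 1)
      = optTotal N f
          (fun k => (s₀.optimalFrom f hf (max y 1) (le_max_right _ _) hyN).W k ω) m := by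
  rcases Nat.eq_zero_or_pos m with rfl | hm0
  · exact optTotal_one hN (W_zero _ ω)
  · rw [optTotal_optimalFrom s₀ f hf _ hyN (by omega) hm,
      optTotal_optimalFrom s₀ f hf _ hyN (by omega) hm.le]

/-- The optimal control attains the explicit formula where the running maximum is `y`. -/
theorem condCost_optimalFrom_ae_eq (hN : 1 ≤ N) (hf : ∀ n ≤ N, 0 < f n) (y : ℕ)
    (hyN : max y 1 ≤ N) (t : ℕ) :
    ∀ᵐ ω ∂(s₀.law ν), runMax t ω = y →
      (s₀.optimalFrom f hf (max y 1) (le_max_right _ _) hyN).condCost ν f t ω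
        = ENNReal.ofReal (s₀.candidate f t ω) := by
  set s := s₀.optimalFrom f hf (max y 1) (le_max_right _ _) hyN with hs
  have hmem : s ∈ s₀.constrained y := fun k hk => funext fun ω =>
    if_pos (hk.trans_le (le_max_left _ _))
  filter_upwards [s.condCost_ae_eq s₀ ν f t] with ω hω hM
  rw [hω, s₀.ofReal_candidate hf, ← s.remaining_congr s₀ hmem hM]
  congr 1
  refine le_antisymm (s.value_le_of_valueUpTo_le ν f t ω fun n => ?_)
    (s.ofReal_remaining_le_value ν hN hf t ω)
  exact s.valueUpTo_le_ofReal_remaining ν hN hf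
    (fun m ω h1 h2 => s₀.optTotal_optimalFrom_succ f hf hN hyN h1 h2 ω) n t ω hM.ge

end RandomScale

end BirthDeath

theorem mainTheorem9 {N : ℕ} (hN : 1 ≤ N) (f : ℕ → ℝ) (hf : ∀ n ≤ N, 0 < f n)
    {E : Type*} [MeasurableSpace E] (ν : Measure E) [IsProbabilityMeasure ν]
    (s₀ : BirthDeath.RandomScale N E) :
    BirthDeath.IsBellmanProcess ν f s₀ (fun t ω => ENNReal.ofReal (s₀.candidate f t ω)) ∧
    ∀ y ≤ N, ∃ s ∈ s₀.constrained y,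
      (∀ x ω, max y 1 ≤ x → x < N →
        s.W x ω = √(s₀.scale (max y 1) ω / s₀.speed f (max y 1) ω)
          * √(2 * BirthDeath.avg f x)) ∧
      ∀ t, ∀ᵐ ω ∂(s₀.law ν), BirthDeath.runMax t ω = y →
        s.condCost ν f t ω = ENNReal.ofReal (s₀.candidate f t ω) := by
  have hattain : ∀ y ≤ N, ∃ s ∈ s₀.constrained y,
      (∀ x ω, max y 1 ≤ x → x < N →
        s.W x ω = √(s₀.scale (max y 1) ω / s₀.speed f (max y 1) ω)
          * √(2 * BirthDeath.avg f x)) ∧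
      ∀ t, ∀ᵐ ω ∂(s₀.law ν), BirthDeath.runMax t ω = y →
        s.condCost ν f t ω = ENNReal.ofReal (s₀.candidate f t ω) := by
    intro y hy
    have hyN : max y 1 ≤ N := max_le hy hN
    refine ⟨s₀.optimalFrom f hf (max y 1) (le_max_right _ _) hyN, fun k hk => funext fun ω =>
      if_pos (hk.trans_le (le_max_left _ _)), fun x ω hx hxN => ?_,
      s₀.condCost_optimalFrom_ae_eq f ν hN hf y hyN⟩
    simp only [BirthDeath.RandomScale.optimalFrom, if_neg (not_lt.2 hx), if_pos hxN]
  refine ⟨fun t y => ?_, hattain⟩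
  rcases lt_or_ge N y with hy | hy
  · have hempty : {ω : BirthDeath.Path N E | BirthDeath.runMax t ω = y} = ∅ :=
      Set.eq_empty_of_forall_notMem fun ω hω =>
        absurd (BirthDeath.runMax_le t ω) (by
          rw [show BirthDeath.runMax t ω = y from hω]; exact not_le.2 hy)
    rw [hempty, Measure.restrict_empty]
    exact ⟨aemeasurable_zero_measure, fun _ _ => by simp [Filter.EventuallyLE],
      fun _ _ _ => by simp [Filter.EventuallyLE]⟩
  · have hset : MeasurableSet {ω : BirthDeath.Path N E | BirthDeath.runMax t ω = y} :=
      BirthDeath.measurable_runMax t (measurableSet_singleton y)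
    -- The candidate is measurable and the greatest lower bound because a control attains it.
    obtain ⟨s, hs, -, heq⟩ := hattain y hy
    have heq' := (ae_restrict_iff' hset).2 (heq t)
    refine ⟨⟨_, measurable_condLExp' _ _ _, heq'.mono fun ω h => h.symm⟩, fun r hr => ?_,
      fun h _ hle => (hle s hs).trans (heq'.mono fun ω h => h.le)⟩
    refine (ae_restrict_iff' hset).2 ?_
    filter_upwards [r.condCost_ae_eq s₀ ν f t] with ω hω hM
    rw [hω, s₀.ofReal_candidate hf, ← r.remaining_congr s₀ hr hM]
    gcongr
    exact r.ofReal_remaining_le_value ν hN hf t ω
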